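/- Let $\mathcal A=(V,V_0,V_1,E)$ be an arena: a finite directed graph $(V,E)$ in which every vertex has an outgoing edge, with $V=V_0\sqcup V_1$ ($V_i$ are the positions of Player $i$). Let $\mathcal G=(\mathcal A,\mathcal F_0,\mathcal F_1)$ be a Muller game: $\mathcal F_0$ is a set of loops (non-empty sets $C\subseteq V$ such that any two $v,v'\in C$ are joined by a path with at least one edge inside $C$), $\mathcal F_1$ is the set of all other loops, and a play $\rho$ is won by Player $0$ iff the set of vertices occurring infinitely often in $\rho$ belongs to $\mathcal F_0$. For a game $\mathcal H$, $W_0(\mathcal H)$ denotes the set of vertices from which Player $0$ has a winning strategy. Assume $W_0(\mathcal G)\neq\emptyset$. Scores. For $F\subseteq V$, $w\in V^+$ and $v\in V$, let $\mathrm{Sc}_{\{v\}}(v)=1$, $\mathrm{Acc}_{\{v\}}(v)=\emptyset$, and $\mathrm{Sc}_F(v)=0$, $\mathrm{Acc}_F(v)=F\cap\{v\}$ if $F\ne\{v\}$. If $v\notin F$, then $\mathrm{Sc}_F(wv)=0$ and $\mathrm{Acc}_F(wv)=\emptyset$. If $v\in F$ and $\mathrm{Acc}_F(w)=F\setminus\{v\}$,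 then $\mathrm{Sc}_F(wv)=\mathrm{Sc}_F(w)+1$ and $\mathrm{Acc}_F(wv)=\emptyset$. If $v\in F$ and $\mathrm{Acc}_F(w)\ne F\setminus\{v\}$, then $\mathrm{Sc}_F(wv)=\mathrm{Sc}_F(w)$ and $\mathrm{Acc}_F(wv)=\mathrm{Acc}_F(w)\cup\{v\}$. Write $w\le_{\mathcal F_1}w'$ if $w,w'$ have the same last vertex and for every $F\in\mathcal F_1$ either $\mathrm{Sc}_F(w)<\mathrm{Sc}_F(w')$, or $\mathrm{Sc}_F(w)=\mathrm{Sc}_F(w')$ and $\mathrm{Acc}_F(w)\subseteq\mathrm{Acc}_F(w')$. Let $w=_{\mathcal F_1}w'$ mean $w\le_{\mathcal F_1}w'\le_{\mathcal F_1}w$, let $[w]$ be the $=_{\mathcal F_1}$-class of $w$, and write $\le_{\mathcal F_1}$ also for the induced partial order on classes. The safety game $\mathcal G_S$. Let $\mathrm{Plays}_{<3}$ be the set of non-empty finite play prefixes $w$ of $\mathcal A$ all of whose prefixes have $\mathrm{Sc}_F\le 2$ for every $F\in\mathcal F_1$, and $\mathrm{Plays}_{=3}$ the set of play prefixes $wv$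 in which some $F\in\mathcal F_1$ reaches score $3$ at the last vertex $v$ while $w\in \mathrm{Plays}_{<3}$. The vertices of $\mathcal G_S$ are the classes $[w]$ with $w\in\mathrm{Plays}_{<3}\cup\mathrm{Plays}_{=3}$; $[w]$ belongs to Player $i$ iff the last vertex of $w$ is in $V_i$; there is an edge from $[w]$ to $[wv]$ for every $w\in\mathrm{Plays}_{<3}$ and every edge of $\mathcal A$ from the last vertex of $w$ to $v$; the other classes get a self-loop. Player $0$ wins a play of $\mathcal G_S$ iff all its vertices are classes of words in $\mathrm{Plays}_{<3}$. Then Player $0$ has a positional strategy in $\mathcal G_S$ that is winning from all of $W_0(\mathcal G_S)$. Moreover, let $\tau$ be any such strategy, let $R$ be the set of vertices of $\mathcal G_S$ visited by plays that are consistent with $\tau$ and start in some $[v]\in W_0(\mathcal G_S)$ with $v\in V$, and let $R_{\max}$ be the set of $\le_{\mathcal F_1}$-maximal elements of $R$. Then 1. $R_{\max}\subseteq W_0(\mathcal G_S)$, and $R_{\max}$ is an antichain for $\le_{\mathcal F_1}$; 2. there are a (finite) memory structure with set of memory states exactly $R_{\max}$, that is, an initialization function $\mathrm{init}\colon V\to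 R_{\max}$ and an update function $\mathrm{upd}\colon R_{\max}\times V\to R_{\max}$ (with extension $\mathrm{upd}^*\colon V^+\to R_{\max}$ given by $\mathrm{upd}^*(v)=\mathrm{init}(v)$, $\mathrm{upd}^*(wv)=\mathrm{upd}(\mathrm{upd}^*(w),v)$), and a next-move function $\mathrm{nxt}$, with $(v,\mathrm{nxt}(v,m))\in E$ for all $v\in V_0$ and $m\in R_{\max}$, such that the strategy $wv\mapsto\mathrm{nxt}(v,\mathrm{upd}^*(wv))$ is winning for Player $0$ in $\mathcal G$ from $W_0(\mathcal G)$; and every non-empty finite prefix $w$ of a play that starts in $W_0(\mathcal G)$ and is consistent with this strategy satisfies $w\in\mathrm{Plays}_{<3}\cup\mathrm{Plays}_{=3}$ and $[w]\le_{\mathcal F_1}\mathrm{upd}^*(w)$. -/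

import Mathlib

namespace MullerSafety

open scoped Classical in
/-- One step of the simultaneous recursion for score and accumulator of `F`: the vertex `v` is
appended to a word with score `p.1` and accumulator `p.2`. -/
noncomputable def scoreStep {V : Type*} (F : Set V) (p : ℕ × Set V) (v : V) : ℕ × Set V :=
  if v ∉ F then (0, ∅)
  else if p.2 = F \ {v} then (p.1 + 1, ∅)
  else (p.1, p.2 ∪ {v})

/-- Score and accumulator of `F` for the word `w`. The empty word gets `(0, ∅)`; by
`scoreAcc_singleton` this start value yields the usual base case for one-letter words. -/
noncomputable def scoreAcc {V : Type*} (F : Set V) (w : List V) : ℕ × Set V :=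
  w.foldl (scoreStep F) (0, ∅)

noncomputable def score {V : Type*} (F : Set V) (w : List V) : ℕ := (scoreAcc F w).1

noncomputable def acc {V : Type*} (F : Set V) (w : List V) : Set V := (scoreAcc F w).2

open scoped Classical in
theorem scoreAcc_singleton {V : Type*} (F : Set V) (v : V) :
    scoreAcc F [v] = if F = {v} then (1, ∅) else (0, F ∩ {v}) := by
  by_cases hv : v ∈ F
  · by_cases hF : F = {v}
    · simp [scoreAcc, scoreStep, hF]
    · have h1 : ¬ (∅ = F \ {v}) := by
        intro h
        exact hF (Set.Subset.antisymm (Set.sdiff_eq_empty.mp h.symm)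
          (Set.singleton_subset_iff.mpr hv))
      have h2 : F ∩ {v} = {v} := Set.inter_eq_right.mpr (Set.singleton_subset_iff.mpr hv)
      simp [scoreAcc, scoreStep, hF, hv, h1, h2]
  · have hF : F ≠ {v} := by rintro rfl; exact hv rfl
    simp [scoreAcc, scoreStep, hF, hv]

theorem scoreAcc_append {V : Type*} (F : Set V) (w : List V) (v : V) :
    scoreAcc F (w ++ [v]) = scoreStep F (scoreAcc F w) v := by
  simp [scoreAcc]

theorem score_append_le {V : Type*} (F : Set V) (w : List V) (v : V) :
    score F (w ++ [v]) ≤ score F w + 1 := by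
  unfold score
  rw [scoreAcc_append]
  unfold scoreStep
  split_ifs <;> simp

/-- The maximal score of a set from `𝓕` that is reached by a prefix of the word `w`. -/
noncomputable def maxScore {V : Type*} (𝓕 : Set (Set V)) (w : List V) : ℕ∞ :=
  ⨆ F ∈ 𝓕, ⨆ u : List V, ⨆ _ : u <+: w, (score F u : ℕ∞)

theorem maxScore_le_iff {V : Type*} {𝓕 : Set (Set V)} {w : List V} {k : ℕ} :
    maxScore 𝓕 w ≤ k ↔ ∀ F ∈ 𝓕, ∀ u : List V, u <+: w → score F u ≤ k := by
  simp [maxScore]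

theorem maxScore_lt_three_iff {V : Type*} {𝓕 : Set (Set V)} {w : List V} :
    maxScore 𝓕 w < 3 ↔ maxScore 𝓕 w ≤ 2 := by
  have h : (3 : ℕ∞) = 2 + 1 := by norm_num
  rw [h, ENat.lt_add_one_iff (by simp)]

/-- `w` is `𝓕`-smaller than `w'` (for non-empty words). -/
def Smaller {V : Type*} (𝓕 : Set (Set V)) (w w' : List V) : Prop :=
  w.getLast? = w'.getLast? ∧
    ∀ F ∈ 𝓕, score F w < score F w' ∨ (score F w = score F w' ∧ acc F w ⊆ acc F w')

theorem Smaller.refl {V : Type*} (𝓕 : Set (Set V)) (w : List V) : Smaller 𝓕 w w :=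
  ⟨rfl, fun _ _ => Or.inr ⟨rfl, subset_rfl⟩⟩

theorem Smaller.trans {V : Type*} {𝓕 : Set (Set V)} {w₁ w₂ w₃ : List V}
    (h : Smaller 𝓕 w₁ w₂) (h' : Smaller 𝓕 w₂ w₃) : Smaller 𝓕 w₁ w₃ := by
  refine ⟨h.1.trans h'.1, fun F hF => ?_⟩
  rcases h.2 F hF with a | ⟨a, b⟩ <;> rcases h'.2 F hF with c | ⟨c, d⟩
  · exact Or.inl (a.trans c)
  · exact Or.inl (by omega)
  · exact Or.inl (by omega)
  · exact Or.inr ⟨a.trans c, b.trans d⟩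

/-- An arena: a finite directed graph without terminal vertices, with the set `V0` of positions
of Player 0; the positions of Player 1 are those in the complement of `V0`. -/
structure Arena (V : Type*) where
  V0 : Set V
  E : V → V → Prop
  finite : Finite V
  total : ∀ v, ∃ v', E v v'

/-- A (non-empty) strongly connected set of vertices: any two of its vertices are joined by a path
with at least one edge that only visits vertices in `C`. -/
def Arena.IsLoop {V : Type*} (A : Arena V) (C : Set V) : Prop :=
  C.Nonempty ∧ ∀ v ∈ C, ∀ v' ∈ C,
    Relation.TransGen (fun a b => a ∈ C ∧ b ∈ C ∧ A.E a b) v v'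

def Arena.IsPlay {V : Type*} (A : Arena V) (ρ : ℕ → V) : Prop :=
  ∀ n, A.E (ρ n) (ρ (n + 1))

/-- A non-empty finite path in the arena. -/
def Arena.IsPlayPrefix {V : Type*} (A : Arena V) (w : List V) : Prop :=
  w ≠ [] ∧ w.IsChain A.E

def occ {V : Type*} (ρ : ℕ → V) : Set V := {v | ∃ n, ρ n = v}

def infi {V : Type*} (ρ : ℕ → V) : Set V := {v | {n | ρ n = v}.Infinite}

/-- The word `ρ 0, …, ρ (n - 1)`. -/
def before {V : Type*} (ρ : ℕ → V) (n : ℕ) : List V := (List.range n).map ρ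

/-- A game: an arena with the set of winning sequences of Player 0. -/
structure Game (V : Type*) where
  arena : Arena V
  Win : Set (ℕ → V)

/-- A strategy for Player 0. `move w v` is the move after the play prefix `wv`; its values at
vertices `v` of Player 1 are irrelevant. -/
structure Strategy {V : Type*} (A : Arena V) where
  move : List V → V → V
  valid : ∀ w, ∀ v ∈ A.V0, A.E v (move w v)

def Strategy.IsPositional {V : Type*} {A : Arena V} (σ : Strategy A) : Prop :=
  ∀ w, ∀ v ∈ A.V0, σ.move w v = σ.move [] v

/-- The plays that start in `v` and are consistent with `σ`. -/
def Strategy.Beh {V : Type*} {A : Arena V} (σ : Strategy A) (v : V) : Set (ℕ → V) :=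
  {ρ | A.IsPlay ρ ∧ ρ 0 = v ∧ ∀ n, ρ n ∈ A.V0 → ρ (n + 1) = σ.move (before ρ n) (ρ n)}

/-- `σ` is a winning strategy for Player 0 from the set `W`. -/
def Game.WinsFrom {V : Type*} (G : Game V) (σ : Strategy G.arena) (W : Set V) : Prop :=
  ∀ v ∈ W, ∀ ρ ∈ σ.Beh v, ρ ∈ G.Win

/-- The winning region of Player 0. -/
def Game.W0 {V : Type*} (G : Game V) : Set V :=
  {v | ∃ σ : Strategy G.arena, G.WinsFrom σ {v}}

/-- A memory structure with (finite) set `M` of memory states. -/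
structure MemoryStructure (V M : Type*) where
  finite : Finite M
  init : V → M
  update : M → V → M

/-- The extension of the update function to non-empty words. -/
def MemoryStructure.updateStar {V M : Type*} (𝔐 : MemoryStructure V M) :
    (w : List V) → w ≠ [] → M
  | v :: w, _ => w.foldl 𝔐.update (𝔐.init v)

/-- A next-move function for Player 0. -/
structure NextMove {V : Type*} (A : Arena V) (M : Type*) where
  nxt : V → M → V
  valid : ∀ v ∈ A.V0, ∀ m, A.E v (nxt v m)

/-- The finite-state strategy implemented by a memory structure and a next-move function. -/
def MemoryStructure.strategy {V M : Type*} {A : Arena V} (𝔐 : MemoryStructure V M)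
    (next : NextMove A M) : Strategy A where
  move w v := next.nxt v (𝔐.updateStar (w ++ [v]) (by simp))
  valid _ v hv := next.valid v hv _

/-- The safety game with set `F` of safe vertices. -/
def safetyGame {V : Type*} (A : Arena V) (F : Set V) : Game V where
  arena := A
  Win := {ρ | occ ρ ⊆ F}

/-- A Muller game, given by its arena and the set of loops that are winning for Player 0. -/
structure MullerGame (V : Type*) where
  arena : Arena V
  F0 : Set (Set V)
  isLoop_of_mem : ∀ C ∈ F0, arena.IsLoop C

namespace MullerGame

/-- The loops that are winning for Player 1. -/
def F1 {V : Type*} (G : MullerGame V) : Set (Set V) := {C | G.arena.IsLoop C ∧ C ∉ G.F0}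

def toGame {V : Type*} (G : MullerGame V) : Game V where
  arena := G.arena
  Win := {ρ | infi ρ ∈ G.F0}

/-- The play prefixes in which all scores of Player 1 are at most 2. -/
def playsLT3 {V : Type*} (G : MullerGame V) : Set (List V) :=
  {w | G.arena.IsPlayPrefix w ∧ maxScore G.F1 w < 3}

/-- The play prefixes in which Player 1 just reached a score of 3. -/
def playsEQ3 {V : Type*} (G : MullerGame V) : Set (List V) :=
  {w | G.arena.IsPlayPrefix w ∧ maxScore G.F1 w = 3 ∧
    ∃ u v, u ≠ [] ∧ w = u ++ [v] ∧ maxScore G.F1 u ≤ 2}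

def PlaysLE3 {V : Type*} (G : MullerGame V) : Type _ :=
  {w : List V // w ∈ G.playsLT3 ∪ G.playsEQ3}

instance {V : Type*} (G : MullerGame V) : Preorder G.PlaysLE3 where
  le p q := Smaller G.F1 p.1 q.1
  le_refl p := Smaller.refl _ p.1
  le_trans _ _ _ h h' := h.trans h'

/-- The quotient of the play prefixes by the equivalence `w ≤ w' ∧ w' ≤ w`, where `≤` is the
`F1`-smaller preorder; it carries the induced partial order. -/
abbrev VS {V : Type*} (G : MullerGame V) : Type _ := Antisymmetrization G.PlaysLE3 (· ≤ ·)

/-- The equivalence class of a play prefix. -/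
def cls {V : Type*} (G : MullerGame V) (p : G.PlaysLE3) : G.VS := toAntisymmetrization (· ≤ ·) p

/-- The classes of play prefixes with scores of Player 1 at most 2. -/
def safe {V : Type*} (G : MullerGame V) : Set G.VS := {a | ∃ p, p.1 ∈ G.playsLT3 ∧ a = G.cls p}

theorem singleton_mem {V : Type*} (G : MullerGame V) (v : V) : [v] ∈ G.playsLT3 := by
  refine ⟨⟨by simp, by simp⟩, maxScore_lt_three_iff.mpr ?_⟩
  refine (maxScore_le_iff (k := 2)).mpr fun F _ u hu => ?_
  have h1 : score F ([] : List V) = 0 := rfl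
  have h2 := score_append_le F [] v
  rcases u with _ | ⟨x, u⟩
  · omega
  · have h3 := hu.length_le
    have h4 : u = [] := by
      apply List.eq_nil_of_length_eq_zero
      simp only [List.length_cons, List.length_nil] at h3
      omega
    subst h4
    have h5 : x = v := by simpa using hu
    subst h5
    simp only [List.nil_append] at h2
    omega

/-- The class of the one-letter word `v`. -/
def single {V : Type*} (G : MullerGame V) (v : V) : G.VS :=
  G.cls ⟨[v], Or.inl (G.singleton_mem v)⟩

theorem append_mem {V : Type*} (G : MullerGame V) {w : List V} (hw : w ∈ G.playsLT3) {v : V}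
    (hv : ∀ x ∈ w.getLast?, G.arena.E x v) : w ++ [v] ∈ G.playsLT3 ∪ G.playsEQ3 := by
  obtain ⟨⟨hne, hch⟩, hlt⟩ := hw
  have hle := maxScore_lt_three_iff.mp hlt
  have hp : G.arena.IsPlayPrefix (w ++ [v]) := by
    refine ⟨by simp, ?_⟩
    rw [List.isChain_append]
    refine ⟨hch, by simp, ?_⟩
    intro x hx y hy
    simp only [List.head?_cons, Option.mem_def, Option.some.injEq] at hy
    subst hy
    exact hv x hx
  have h3 : maxScore G.F1 (w ++ [v]) ≤ 3 := by
    refine (maxScore_le_iff (k := 3)).mpr fun F hF u hu => ?_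
    rcases List.prefix_concat_iff.mp hu with h | h
    · have h1 := score_append_le F w v
      have h2 := (maxScore_le_iff (k := 2)).mp hle F hF w (List.prefix_refl w)
      rw [h]
      omega
    · have h2 := (maxScore_le_iff (k := 2)).mp hle F hF u h
      omega
  rcases lt_or_eq_of_le h3 with h | h
  · exact Or.inl ⟨hp, h⟩
  · exact Or.inr ⟨hp, h, w, v, hne, rfl, hle⟩

theorem score_le_three {V : Type*} (G : MullerGame V) (p : G.PlaysLE3) {F : Set V}
    (hF : F ∈ G.F1) : score F p.1 ≤ 3 := by
  have h : maxScore G.F1 p.1 ≤ 3 := by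
    rcases p.2 with h | h
    · exact h.2.le
    · exact h.2.1.le
  exact (maxScore_le_iff (k := 3)).mp h F hF p.1 (List.prefix_refl _)

theorem finite_VS {V : Type*} (G : MullerGame V) : Finite G.VS := by
  have := G.arena.finite
  let φ : G.VS → Option V × (Set V → Fin 4 × Set V) := fun a =>
    let p := ofAntisymmetrization (· ≤ ·) a
    (p.1.getLast?, fun F => (Fin.ofNat 4 (score F p.1), acc F p.1))
  refine Finite.of_injective φ fun a b hab => ?_
  rw [← toAntisymmetrization_ofAntisymmetrization (· ≤ ·) a,
    ← toAntisymmetrization_ofAntisymmetrization (· ≤ ·) b]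
  generalize hp : ofAntisymmetrization (· ≤ ·) a = p at *
  generalize hq : ofAntisymmetrization (· ≤ ·) b = q at *
  have h1 : p.1.getLast? = q.1.getLast? := by
    have := congrArg Prod.fst hab
    simpa [φ, hp, hq] using this
  have h2 : ∀ F ∈ G.F1, score F p.1 = score F q.1 ∧ acc F p.1 = acc F q.1 := by
    intro F hF
    have h := congrFun (congrArg Prod.snd hab) F
    simp only [φ, hp, hq, Prod.mk.injEq] at h
    refine ⟨?_, h.2⟩
    have h3 := congrArg Fin.val h.1
    simp only [Fin.ofNat] at h3
    have h4 := G.score_le_three p hF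
    have h5 := G.score_le_three q hF
    omega
  refine Quotient.sound ⟨⟨h1, fun F hF => Or.inr ⟨(h2 F hF).1, (h2 F hF).2.subset⟩⟩,
    ⟨h1.symm, fun F hF => Or.inr ⟨(h2 F hF).1.symm, (h2 F hF).2.symm.subset⟩⟩⟩

/-- The arena of the safety game. There is an edge from the class of `w` to the class of `wv`
whenever all scores in `w` are at most 2; the remaining (losing and otherwise terminal) classes
get a self-loop. -/
def arenaS {V : Type*} (G : MullerGame V) : Arena G.VS where
  V0 := {a | ∃ p : G.PlaysLE3, a = G.cls p ∧ ∃ x ∈ G.arena.V0, p.1.getLast? = some x}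
  E a b := (∃ (p q : G.PlaysLE3) (v : V), p.1 ∈ G.playsLT3 ∧ q.1 = p.1 ++ [v] ∧
      a = G.cls p ∧ b = G.cls q) ∨ (a ∉ G.safe ∧ b = a)
  finite := G.finite_VS
  total a := by
    by_cases ha : a ∈ G.safe
    · obtain ⟨p, hp, rfl⟩ := ha
      obtain ⟨v, hv⟩ := G.arena.total (p.1.getLast hp.1.1)
      refine ⟨G.cls ⟨p.1 ++ [v], G.append_mem hp ?_⟩, Or.inl ⟨p, _, v, hp, rfl, rfl, rfl⟩⟩
      intro x hx
      rw [List.getLast?_eq_some_getLast hp.1.1] at hx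
      simp only [Option.mem_def, Option.some.injEq] at hx
      exact hx ▸ hv
    · exact ⟨a, Or.inr ⟨ha, rfl⟩⟩

/-- The safety game associated with a Muller game: Player 0 has to prevent a score of 3 of her
opponent. -/
def gameS {V : Type*} (G : MullerGame V) : Game G.VS := safetyGame G.arenaS G.safe

/-- The vertices of the safety game that are visited by plays that are consistent with `σ` and
start in the class of a one-letter word that belongs to the winning region of Player 0. -/
def reach {V : Type*} (G : MullerGame V) (σ : Strategy G.gameS.arena) : Set G.VS :=
  {a | ∃ v : V, G.single v ∈ G.gameS.W0 ∧ ∃ ρ ∈ σ.Beh (G.single v), ∃ n, ρ n = a}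

/-- The maximal elements of the set of reachable vertices. -/
def reachMax {V : Type*} (G : MullerGame V) (σ : Strategy G.gameS.arena) : Set G.VS :=
  {a | Maximal (· ∈ G.reach σ) a}

end MullerGame

end MullerSafety

open MullerSafety

/-!
The combinatorial heart is that Player 0 can win the Muller game from its winning region while
keeping all scores of Player 1 at most 2 (`boundsScores_of_winnable`). It is proved by induction on
a subgame `X` in which Player 0 wins everywhere, in a form that can be iterated: the play may start
after any `Burden`, a word after which each relevant set has score 0 or has just completed its first
round. A (non-deterministic) strategy is encoded by the set of play prefixes it allows (`Closed`),
so that no finite-memory bookkeeping is needed.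

* If `X` is a winning loop of Player 1, then a winning strategy of Player 0 has a position from
  which some vertex of `X` can no longer be reached. The vertices that are still reachable form a
  smaller subgame `Y` in which Player 0 wins everywhere and which Player 1 cannot leave
  (`exists_winnable_trap`); this uses no determinacy. Player 0 bounds the scores by induction
  outside of the attractor of `Y`, moves to `Y` in the attractor, and bounds the scores by induction
  in `Y` (`boundsScores_of_trap`).
* Otherwise Player 0 picks a set `C ⊂ X` of Player 1 that covers as long a suffix of the play prefix
  as possible. The sets that are covered by suffixes form a chain, so every other set of Player 1 is
  inside `C`, or it has score 0 and an accumulator inside `C`. Player 0 bounds the scores by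
  induction outside of the attractor of `X \ C` and moves to `X \ C` in the attractor. As soon as
  the play leaves `C`, all subsets of `C` are reset and all other sets have completed at most one
  round, so the play prefix is a burden again (`boundsScores_of_notMem`).

In both cases the remaining sets have score at most 1 outside of the attractor. From then on
they complete at most one more: in the attractor because the rank decreases along the play, and in
`Y` because they are not contained in `Y` (`LacksAt`).

Since score and accumulator behave monotonically when a letter is appended, the safety game does not
depend on the choice of representatives, and a score-bounding strategy yields
`W₀(𝒢) ⊆ {v | [v] ∈ W₀(𝒢_S)}` (`MullerGame.single_mem_W0`). By the same monotonicity, the memory can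
replace the class of the current play prefix by any maximal reachable class above it and move as the
given positional strategy does there (`MullerGame.exists_memoryStructure`). These classes are safe,
so all scores along the play are at most 2, whereas the score of the set of infinitely often visited
vertices is unbounded (`exists_score_infi_ge`); hence that set is not winning for Player 1.
-/

namespace MullerSafety

variable {V : Type*}

/-! ### Scores and accumulators -/

theorem score_acc_append_of_notMem {F : Set V} {v : V} (hv : v ∉ F) (w : List V) :
    score F (w ++ [v]) = 0 ∧ acc F (w ++ [v]) = ∅ := by
  simp [score, acc, scoreAcc_append, scoreStep, hv]

theorem score_acc_append_of_eq {F : Set V} {v : V} (hv : v ∈ F) {w : List V}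
    (h : acc F w = F \ {v}) :
    score F (w ++ [v]) = score F w + 1 ∧ acc F (w ++ [v]) = ∅ := by
  unfold score acc at *
  simp [scoreAcc_append, scoreStep, hv, h]

theorem score_acc_append_of_ne {F : Set V} {v : V} (hv : v ∈ F) {w : List V}
    (h : acc F w ≠ F \ {v}) :
    score F (w ++ [v]) = score F w ∧ acc F (w ++ [v]) = acc F w ∪ {v} := by
  unfold score acc at *
  simp [scoreAcc_append, scoreStep, hv, h]

/-- The three ways in which score and accumulator of `F` can change when `v` is appended. -/
theorem score_acc_append_cases (F : Set V) (w : List V) (v : V) :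
    (v ∉ F ∧ score F (w ++ [v]) = 0 ∧ acc F (w ++ [v]) = ∅) ∨
    (v ∈ F ∧ acc F w = F \ {v} ∧ score F (w ++ [v]) = score F w + 1 ∧ acc F (w ++ [v]) = ∅) ∨
    (v ∈ F ∧ acc F w ≠ F \ {v} ∧ score F (w ++ [v]) = score F w ∧
      acc F (w ++ [v]) = acc F w ∪ {v}) := by
  by_cases hv : v ∈ F
  · by_cases h : acc F w = F \ {v}
    · exact Or.inr (Or.inl ⟨hv, h, score_acc_append_of_eq hv h⟩)
    · exact Or.inr (Or.inr ⟨hv, h, score_acc_append_of_ne hv h⟩)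
  · exact Or.inl ⟨hv, score_acc_append_of_notMem hv w⟩

theorem acc_subset (F : Set V) (w : List V) : acc F w ⊆ F := by
  induction w using List.reverseRecOn with
  | nil => simp [acc, scoreAcc]
  | append_singleton w v ih =>
    rcases score_acc_append_cases F w v with ⟨-, -, h⟩ | ⟨-, -, -, h⟩ | ⟨hv, -, -, h⟩
    · simp [h]
    · simp [h]
    · rw [h]
      exact Set.union_subset ih (Set.singleton_subset_iff.mpr hv)

theorem acc_subset_letters (F : Set V) (w : List V) : acc F w ⊆ {x | x ∈ w} := by
  induction w using List.reverseRecOn with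
  | nil => simp [acc, scoreAcc]
  | append_singleton w v ih =>
    rcases score_acc_append_cases F w v with ⟨-, -, h⟩ | ⟨-, -, -, h⟩ | ⟨hv, -, -, h⟩
    · simp [h]
    · simp [h]
    · rw [h]
      rintro x (hx | hx)
      · simpa using Or.inl (ih hx)
      · simpa using Or.inr hx

/-- The accumulator is emptied as soon as it would become all of `F`. -/
theorem acc_ne {F : Set V} (hF : F.Nonempty) (w : List V) : acc F w ≠ F := by
  induction w using List.reverseRecOn with
  | nil => simpa [acc, scoreAcc] using hF.ne_empty.symm
  | append_singleton w v ih =>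
    rcases score_acc_append_cases F w v with ⟨-, -, h⟩ | ⟨-, -, -, h⟩ | ⟨hv, hne, -, h⟩
    · rw [h]
      exact hF.ne_empty.symm
    · rw [h]
      exact hF.ne_empty.symm
    · intro h'
      rw [h] at h'
      by_cases hva : v ∈ acc F w
      · rw [Set.union_eq_self_of_subset_right (Set.singleton_subset_iff.mpr hva)] at h'
        exact ih h'
      · apply hne
        calc acc F w = acc F w \ {v} := (Set.sdiff_singleton_eq_self hva).symm
          _ = (acc F w ∪ {v}) \ {v} := Set.union_sdiff_right.symm
          _ = F \ {v} := by rw [h']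

theorem score_acc_of_getLast?_notMem {F : Set V} {w : List V} {x : V}
    (hw : w.getLast? = some x) (hx : x ∉ F) : score F w = 0 ∧ acc F w = ∅ := by
  obtain ⟨u, rfl⟩ := List.getLast?_eq_some_iff.mp hw
  exact score_acc_append_of_notMem hx u

theorem score_eq_zero_of_not_subset {F : Set V} {w : List V} (h : ¬ F ⊆ {x | x ∈ w}) :
    score F w = 0 := by
  induction w using List.reverseRecOn with
  | nil => rfl
  | append_singleton w v ih =>
    have h' : ¬ F ⊆ {x | x ∈ w} := fun hF => h fun x hx => by simpa using Or.inl (hF hx)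
    rcases score_acc_append_cases F w v with ⟨-, h1, -⟩ | ⟨-, h2, -, -⟩ | ⟨-, -, h1, -⟩
    · exact h1
    · refine absurd (fun x hx => ?_) h
      by_cases hxv : x = v
      · simp [hxv]
      · have : x ∈ acc F w := h2 ▸ ⟨hx, hxv⟩
        simpa using Or.inl (acc_subset_letters F w this)
    · rw [h1, ih h']

/-- Appending the same letter to two words preserves the comparison of score and accumulator. -/
theorem score_acc_append_mono {F : Set V} (hF : F.Nonempty) {w w' : List V}
    (h : score F w < score F w' ∨ (score F w = score F w' ∧ acc F w ⊆ acc F w')) (v : V) :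
    score F (w ++ [v]) < score F (w' ++ [v]) ∨
      (score F (w ++ [v]) = score F (w' ++ [v]) ∧ acc F (w ++ [v]) ⊆ acc F (w' ++ [v])) := by
  rcases score_acc_append_cases F w v with ⟨a1, a2, a3⟩ | ⟨a1, a2, a3, a4⟩ | ⟨a1, a2, a3, a4⟩ <;>
  rcases score_acc_append_cases F w' v with ⟨b1, b2, b3⟩ | ⟨b1, b2, b3, b4⟩ | ⟨b1, b2, b3, b4⟩
  · right; simp [a2, a3, b2]
  · exact absurd b1 a1
  · exact absurd b1 a1
  · exact absurd a1 b1
  · rcases h with h | h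
    · left; omega
    · right; exact ⟨by omega, by simp [a4]⟩
  · rcases h with h | ⟨h, h'⟩
    · rcases (by omega : score F w + 1 < score F w' ∨ score F w + 1 = score F w') with h | h
      · left; omega
      · right; exact ⟨by omega, by simp [a4]⟩
    · exfalso
      rw [a2] at h'
      by_cases hv : v ∈ acc F w'
      · refine acc_ne hF w' (Set.Subset.antisymm (acc_subset F w') fun x hx => ?_)
        by_cases hxv : x = v
        · exact hxv ▸ hv
        · exact h' ⟨hx, hxv⟩
      · refine b2 (Set.Subset.antisymm (fun x hx => ⟨acc_subset F w' hx, ?_⟩) h')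
        rintro rfl
        exact hv hx
  · exact absurd a1 b1
  · rcases h with h | h
    · left; omega
    · left; omega
  · rcases h with h | h
    · left; omega
    · right
      refine ⟨by omega, ?_⟩
      rw [a4, b4]
      exact Set.union_subset_union_left _ h.2

/-! ### The part of a set that is covered by a suffix -/

open scoped Classical in
/-- The set of letters of the longest suffix of `w` that only uses letters from `F`, expressed
through score and accumulator. -/
noncomputable def reached (F : Set V) (w : List V) : Set V :=
  if score F w = 0 then acc F w else F

theorem reached_subset (F : Set V) (w : List V) : reached F w ⊆ F := by
  unfold reached
  split_ifs
  · exact acc_subset F w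
  · exact subset_rfl

theorem reached_nil (F : Set V) : reached F [] = ∅ := by
  simp [reached, score, acc, scoreAcc]

theorem reached_append_of_notMem {F : Set V} {v : V} (hv : v ∉ F) (w : List V) :
    reached F (w ++ [v]) = ∅ := by
  obtain ⟨h1, h2⟩ := score_acc_append_of_notMem hv w
  simp [reached, h1, h2]

theorem reached_append_of_mem {F : Set V} {v : V} (hv : v ∈ F) (w : List V) :
    reached F (w ++ [v]) = reached F w ∪ {v} := by
  have hF : F ∪ {v} = F := Set.union_eq_self_of_subset_right (Set.singleton_subset_iff.mpr hv)
  rcases score_acc_append_cases F w v with ⟨h, -⟩ | ⟨-, h1, h2, h3⟩ | ⟨-, h1, h2, h3⟩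
  · exact absurd hv h
  · by_cases hs : score F w = 0
    · simp only [reached, hs, h1, h2, if_true, Set.sdiff_union_self, hF]
      simp
    · simp [reached, hs, h2, hF]
  · by_cases hs : score F w = 0
    · simp [reached, hs, h2, h3]
    · simp [reached, hs, h2, hF]

/-- Suffixes of one word are nested. -/
theorem reached_total (F F' : Set V) (w : List V) :
    reached F w ⊆ reached F' w ∨ reached F' w ⊆ reached F w := by
  induction w using List.reverseRecOn with
  | nil => simp [reached_nil]
  | append_singleton w v ih =>
    by_cases hv : v ∈ F
    · by_cases hv' : v ∈ F'
      · rw [reached_append_of_mem hv, reached_append_of_mem hv']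
        exact ih.imp (Set.union_subset_union_left _) (Set.union_subset_union_left _)
      · right; simp [reached_append_of_notMem hv']
    · left; simp [reached_append_of_notMem hv]

/-- In a finite non-empty family there is a set `C` such that all sets of the family which are not
contained in `C` have score `0` and an accumulator inside `C`. -/
theorem exists_score_eq_zero_of_not_subset [Finite V] {𝓖 : Set (Set V)} (h𝓖 : 𝓖.Nonempty)
    (w : List V) :
    ∃ C ∈ 𝓖, (∀ F ∈ 𝓖, ¬ F ⊆ C → score F w = 0 ∧ acc F w ⊆ C) ∧
      ∀ F ∈ 𝓖, reached F w ⊆ reached C w := by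
  obtain ⟨C, hC, hmax⟩ := (Set.toFinite 𝓖).exists_maximalFor (fun F => reached F w) 𝓖 h𝓖
  have key : ∀ F ∈ 𝓖, reached F w ⊆ reached C w := fun F hF =>
    (reached_total F C w).elim id fun h => hmax hF h
  refine ⟨C, hC, fun F hF hFC => ?_, key⟩
  have h := (key F hF).trans (reached_subset C w)
  unfold reached at h
  split_ifs at h with hs
  · exact ⟨hs, h⟩
  · exact absurd h hFC

/-! ### Invariants of scores along a play -/

theorem score_append_of_score_eq_zero {F : Set V} {w : List V} (h : score F w = 0) (v : V) :
    score F (w ++ [v]) = 0 ∨ (score F (w ++ [v]) = 1 ∧ acc F (w ++ [v]) = ∅) := by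
  rcases score_acc_append_cases F w v with ⟨-, h1, -⟩ | ⟨-, -, h1, h2⟩ | ⟨-, -, h1, -⟩
  · exact Or.inl h1
  · exact Or.inr ⟨by omega, h2⟩
  · exact Or.inl (by omega)

/-- As long as a play stays in `Z`, a set `F` that is not contained in `Z` completes at most one
round. -/
theorem score_le_one_append {F Z : Set V} (hFZ : ¬ F ⊆ Z) {w : List V}
    (h : score F w = 0 ∨ (score F w = 1 ∧ acc F w ⊆ Z)) {v : V} (hv : v ∈ Z) :
    score F (w ++ [v]) = 0 ∨ (score F (w ++ [v]) = 1 ∧ acc F (w ++ [v]) ⊆ Z) := by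
  rcases h with h | ⟨h, h'⟩
  · exact (score_append_of_score_eq_zero h v).imp id fun h => ⟨h.1, by simp [h.2]⟩
  · rcases score_acc_append_cases F w v with ⟨-, h1, -⟩ | ⟨-, h2, -, -⟩ | ⟨-, -, h1, h2⟩
    · exact Or.inl h1
    · refine absurd (fun x hx => ?_) hFZ
      by_cases hxv : x = v
      · exact hxv ▸ hv
      · exact h' (h2 ▸ ⟨hx, hxv⟩)
    · exact Or.inr ⟨by omega, h2 ▸ Set.union_subset h' (Set.singleton_subset_iff.mpr hv)⟩

theorem score_zero_acc_subset_append {F C : Set V} (hFC : ¬ F ⊆ C) {w : List V}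
    (h : score F w = 0 ∧ acc F w ⊆ C) {v : V} (hv : v ∈ C) :
    score F (w ++ [v]) = 0 ∧ acc F (w ++ [v]) ⊆ C := by
  obtain ⟨h, h'⟩ := h
  rcases score_acc_append_cases F w v with ⟨-, h1, h2⟩ | ⟨-, h2, -, -⟩ | ⟨-, -, h1, h2⟩
  · exact ⟨h1, by simp [h2]⟩
  · refine absurd (fun x hx => ?_) hFC
    by_cases hxv : x = v
    · exact hxv ▸ hv
    · exact h' (h2 ▸ ⟨hx, hxv⟩)
  · exact ⟨by omega, h2 ▸ Set.union_subset h' (Set.singleton_subset_iff.mpr hv)⟩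

/-- The score of `F` is at most 2, and if it is 2, then the current round of `F` lacks a vertex
from `Q`. When the play avoids `Q` from now on, the score of `F` cannot reach 3. -/
def LacksAt (Q F : Set V) (w : List V) : Prop :=
  score F w ≤ 1 ∨ (score F w = 2 ∧ ∃ y ∈ Q ∩ F, y ∉ acc F w)

theorem LacksAt.score_le_two {Q F : Set V} {w : List V} (h : LacksAt Q F w) : score F w ≤ 2 := by
  rcases h with h | h
  · omega
  · exact h.1.le

theorem LacksAt.append {Q Q' F : Set V} {w : List V} (h : LacksAt Q F w) {v : V} (hv : v ∉ Q)
    (hQ : Q ⊆ Q') (hF : v ∈ F → (Q' ∩ F).Nonempty) : LacksAt Q' F (w ++ [v]) := by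
  rcases score_acc_append_cases F w v with ⟨-, h1, -⟩ | ⟨hvF, h2, h1, h3⟩ | ⟨hvF, -, h1, h2⟩
  · left; omega
  · rcases h with h | ⟨-, y, hy, hy'⟩
    · rcases (by omega : score F (w ++ [v]) ≤ 1 ∨ score F (w ++ [v]) = 2) with h4 | h4
      · exact Or.inl h4
      · obtain ⟨y, hy⟩ := hF hvF
        exact Or.inr ⟨h4, y, hy, by simp [h3]⟩
    · refine absurd ?_ hy'
      rw [h2]
      exact ⟨hy.2, fun h => hv (by rw [← show y = v from h]; exact hy.1)⟩
  · rcases h with h | ⟨h, y, hy, hy'⟩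
    · left; omega
    · refine Or.inr ⟨by omega, y, ⟨hQ hy.1, hy.2⟩, ?_⟩
      rw [h2]
      rintro (h3 | h3)
      · exact hy' h3
      · exact hv (by rw [← show y = v from h3]; exact hy.1)

/-- After `w`, every set of the family that is contained in `X` has score 0, or it has just
completed its first round. -/
def Burden (𝓕 : Set (Set V)) (X : Set V) (w : List V) : Prop :=
  ∀ F ∈ 𝓕, F ⊆ X → score F w = 0 ∨ (score F w = 1 ∧ acc F w = ∅)

theorem Burden.mono {𝓕 : Set (Set V)} {X Y : Set V} {w : List V} (h : Burden 𝓕 X w)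
    (hY : Y ⊆ X) : Burden 𝓕 Y w :=
  fun F hF hFY => h F hF (hFY.trans hY)

theorem burden_append {𝓕 : Set (Set V)} {X : Set V} {w : List V} {x : V}
    (hw : w.getLast? = some x) (hx : x ∉ X) (v : V) : Burden 𝓕 X (w ++ [v]) := fun _ _ hFX =>
  score_append_of_score_eq_zero (score_acc_of_getLast?_notMem hw fun h => hx (hFX h)).1 v

theorem burden_singleton (𝓕 : Set (Set V)) (X : Set V) (v : V) : Burden 𝓕 X [v] := fun F _ _ =>
  score_append_of_score_eq_zero (w := []) (F := F) rfl v

/-! ### Closed sets of words -/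

/-- A set of words that end in `X` and that Player 0 can refuse to leave, as long as Player 1 only
moves to vertices in `X`. Such a set is a non-deterministic strategy for Player 0 in the subgame
induced by `X`, given by the play prefixes that it allows. -/
def Closed (A : Arena V) (X : Set V) (S : Set (List V)) : Prop :=
  ∀ w ∈ S, ∃ x ∈ X, w.getLast? = some x ∧
    (x ∈ A.V0 → ∃ v ∈ X, A.E x v ∧ w ++ [v] ∈ S) ∧
    (x ∉ A.V0 → ∀ v ∈ X, A.E x v → w ++ [v] ∈ S)

/-- The words from which Player 0 can stay in `X` while keeping the scores of all sets of the
family inside `X` at most 2. -/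
def Bounded (A : Arena V) (𝓕 : Set (Set V)) (X : Set V) : Set (List V) :=
  {w | ∃ S, Closed A X S ∧ w ∈ S ∧ ∀ u ∈ S, ∀ F ∈ 𝓕, F ⊆ X → score F u ≤ 2}

theorem closed_bounded (A : Arena V) (𝓕 : Set (Set V)) (X : Set V) :
    Closed A X (Bounded A 𝓕 X) := by
  rintro w ⟨S, hS, hw, hs⟩
  obtain ⟨x, hx, hl, h0, h1⟩ := hS w hw
  refine ⟨x, hx, hl, fun h => ?_, fun h v hv hE => ⟨S, hS, h1 h v hv hE, hs⟩⟩
  obtain ⟨v, hv, hE, hvS⟩ := h0 h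
  exact ⟨v, hv, hE, S, hS, hvS, hs⟩

theorem score_le_two_of_mem_bounded {A : Arena V} {𝓕 : Set (Set V)} {X : Set V} {w : List V}
    (hw : w ∈ Bounded A 𝓕 X) {F : Set V} (hF : F ∈ 𝓕) (hFX : F ⊆ X) : score F w ≤ 2 := by
  obtain ⟨S, -, hw, hs⟩ := hw
  exact hs w hw F hF hFX

/-- Player 0 can bound the scores by 2 in the subgame `X`, starting after any burden. -/
def BoundsScores (A : Arena V) (𝓕 : Set (Set V)) (X : Set V) : Prop :=
  ∀ w x, w.getLast? = some x → x ∈ X → Burden 𝓕 X w → w ∈ Bounded A 𝓕 X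

/-- A non-deterministic strategy for Player 0 in the subgame `X` all of whose plays avoid the
family `𝓕` as set of infinitely often visited vertices. -/
def WinTree (A : Arena V) (𝓕 : Set (Set V)) (X : Set V) (T : Set (List V)) : Prop :=
  Closed A X T ∧ ∀ (w : ℕ → List V) (r : ℕ → V), (∀ n, w n ∈ T) →
    (∀ n, w (n + 1) = w n ++ [r n]) → infi r ∉ 𝓕

/-- Player 0 wins from every vertex of the subgame `X`. -/
def Winnable (A : Arena V) (𝓕 : Set (Set V)) (X : Set V) : Prop :=
  ∀ x ∈ X, ∃ T, WinTree A 𝓕 X T ∧ ∃ w ∈ T, w.getLast? = some x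

/-- Player 0 also wins from everywhere in a subgame that only Player 1 can leave. -/
theorem Winnable.of_trap {A : Arena V} {𝓕 : Set (Set V)} {X Z : Set V} (h : Winnable A 𝓕 X)
    (hZ : Z ⊆ X) (htrap : ∀ x ∈ Z, x ∈ A.V0 → ∀ v ∈ X, A.E x v → v ∈ Z) :
    Winnable A 𝓕 Z := by
  intro z hz
  obtain ⟨T, ⟨hT, hwin⟩, w, hw, hl⟩ := h z (hZ hz)
  refine ⟨{u ∈ T | ∃ x ∈ Z, u.getLast? = some x}, ⟨?_, fun u r hu hr =>
    hwin u r (fun n => (hu n).1) hr⟩, w, ⟨hw, z, hz, hl⟩, hl⟩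
  rintro u ⟨hu, x, hx, hlx⟩
  obtain ⟨x', hx', hlx', h0, h1⟩ := hT u hu
  obtain rfl : x = x' := by rw [hlx] at hlx'; exact Option.some.inj hlx'
  refine ⟨x, hx, hlx, fun hV => ?_, fun hV v hv hE => ⟨h1 hV v (hZ hv) hE, v, hv, by simp⟩⟩
  obtain ⟨v, hv, hE, hvT⟩ := h0 hV
  exact ⟨v, htrap x hx hV v hv hE, hE, hvT, v, htrap x hx hV v hv hE, by simp⟩

/-! ### Attractors -/

/-- The `n`-th level of the attractor of Player 0 to `T` in the subgame `X`. -/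
def attrLevel (A : Arena V) (X T : Set V) : ℕ → Set V
  | 0 => X ∩ T
  | n + 1 => attrLevel A X T n ∪ {x ∈ X | (x ∈ A.V0 → ∃ v ∈ attrLevel A X T n, A.E x v) ∧
      (x ∉ A.V0 → ∀ v ∈ X, A.E x v → v ∈ attrLevel A X T n)}

theorem attrLevel_subset (A : Arena V) (X T : Set V) (n : ℕ) : attrLevel A X T n ⊆ X := by
  induction n with
  | zero => exact Set.inter_subset_left
  | succ n ih => exact Set.union_subset ih fun x hx => hx.1

/-- The complement `Z` of the attractor of Player 0 to `T` in the subgame `X`: Player 0 cannot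
leave `Z`, and outside of `Z` she can decrease a rank until `T` is reached. -/
theorem exists_trap_and_rank [Finite V] (A : Arena V) (X T : Set V) :
    ∃ (Z : Set V) (rank : V → ℕ), Z ⊆ X ∧ Disjoint Z T ∧
      (∀ x ∈ Z, x ∈ A.V0 → ∀ v ∈ X, A.E x v → v ∈ Z) ∧
      (∀ x ∈ X \ Z, x ∉ T → x ∈ A.V0 → ∃ v ∈ X \ Z, A.E x v ∧ rank v < rank x) ∧
      (∀ x ∈ X \ Z, x ∉ T → x ∉ A.V0 → ∀ v ∈ X, A.E x v → v ∉ Z ∧ rank v < rank x) := by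
  classical
  let L := attrLevel A X T
  let rank : V → ℕ := fun x => if h : ∃ n, x ∈ L n then Nat.find h else 0
  have rank_le : ∀ {x n}, x ∈ L n → rank x ≤ n := fun {x n} h => by
    have h' : ∃ n, x ∈ L n := ⟨n, h⟩
    simp only [rank, dif_pos h']
    exact Nat.find_min' h' h
  have mem_rank : ∀ {x n}, x ∈ L n → x ∈ L (rank x) := fun {x n} h => by
    have h' : ∃ n, x ∈ L n := ⟨n, h⟩
    simp only [rank, dif_pos h']
    exact Nat.find_spec h'
  have step : ∀ x ∈ X \ {x ∈ X | ∀ n, x ∉ L n}, x ∉ T → ∃ n, rank x = n + 1 ∧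
      (x ∈ A.V0 → ∃ v ∈ L n, A.E x v) ∧ (x ∉ A.V0 → ∀ v ∈ X, A.E x v → v ∈ L n) := by
    rintro x ⟨hx, hx'⟩ hT
    have h : ∃ n, x ∈ L n := by
      by_contra h
      exact hx' ⟨hx, not_exists.mp h⟩
    obtain ⟨n, hn⟩ := h
    have hr := mem_rank hn
    rcases h : rank x with _ | m
    · rw [h] at hr
      exact absurd hr.2 hT
    · rw [h] at hr
      rcases hr with hr | hr
      · have := rank_le hr
        omega
      · exact ⟨m, rfl, hr.2⟩
  refine ⟨{x ∈ X | ∀ n, x ∉ L n}, rank, fun x hx => hx.1, ?_, ?_, ?_, ?_⟩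
  · exact Set.disjoint_left.mpr fun x hx hT => hx.2 0 ⟨hx.1, hT⟩
  · refine fun x hx hV v hv hE => ⟨hv, fun n hn => hx.2 (n + 1) (Or.inr ⟨hx.1, fun _ => ⟨v, hn, hE⟩,
      fun h => absurd hV h⟩)⟩
  · intro x hx hT hV
    obtain ⟨n, hn, h, -⟩ := step x hx hT
    obtain ⟨v, hv, hE⟩ := h hV
    exact ⟨v, ⟨attrLevel_subset A X T n hv, fun h => h.2 n hv⟩, hE,
      (rank_le hv).trans_lt (by omega)⟩
  · intro x hx hT hV v hv hE
    obtain ⟨n, hn, -, h⟩ := step x hx hT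
    have hv' := h hV v hv hE
    exact ⟨fun h => h.2 n hv', (rank_le hv').trans_lt (by omega)⟩

/-! ### Paths that visit given targets infinitely often -/

/-- If from every state each target can be reached, then there is a path that visits the targets
one after the other. -/
theorem exists_path_visiting {α : Type*} (R : α → α → Prop) (p : ℕ → Set α)
    (hsucc : ∀ a, ∃ b, R a b) (hreach : ∀ n a, ∃ b ∈ p n, Relation.ReflTransGen R a b) (a₀ : α) :
    ∃ f : ℕ → α, (∀ k, R (f k) (f (k + 1))) ∧
      ∃ j : ℕ → ℕ, j.Injective ∧ ∀ m, f (j m) ∈ p m := by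
  classical
  -- the states from which the target `n` can be reached in exactly `k` steps
  let D : ℕ → ℕ → Set α := fun n k =>
    Nat.rec (p n) (fun _ s => {a | ∃ b, R a b ∧ b ∈ s}) k
  have hD : ∀ n a, ∃ k, a ∈ D n k := by
    intro n a
    obtain ⟨b, hb, hab⟩ := hreach n a
    induction hab using Relation.ReflTransGen.head_induction_on with
    | refl => exact ⟨0, hb⟩
    | head h _ ih =>
      obtain ⟨k, hk⟩ := ih
      exact ⟨k + 1, _, h, hk⟩
  let d : ℕ → α → ℕ := fun n a => sInf {k | a ∈ D n k}
  have hstep : ∀ n a, a ∉ p n → ∃ b, R a b ∧ d n b < d n a := by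
    intro n a ha
    have h : a ∈ D n (d n a) := Nat.sInf_mem (hD n a)
    rcases hk : d n a with _ | k
    · rw [hk] at h
      exact absurd h ha
    · rw [hk] at h
      obtain ⟨b, hab, hb⟩ := h
      exact ⟨b, hab, Nat.lt_succ_of_le (Nat.sInf_le hb)⟩
  choose s hs using hsucc
  choose t ht ht' using hstep
  let step : α × ℕ → α × ℕ := fun q =>
    if h : q.1 ∈ p q.2 then (s q.1, q.2 + 1) else (t q.2 q.1 h, q.2)
  let g : ℕ → α × ℕ := fun k => step^[k] (a₀, 0)
  have hg : ∀ k, g (k + 1) = step (g k) := fun k => Function.iterate_succ_apply' step k _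
  have hR : ∀ k, R (g k).1 (g (k + 1)).1 := by
    intro k
    rw [hg]
    simp only [step]
    split_ifs with h
    · exact hs _
    · exact ht _ _ h
  have hvisit : ∀ N k, d (g k).2 (g k).1 = N → ∃ j, (g j).2 = (g k).2 ∧ (g j).1 ∈ p (g k).2 := by
    intro N
    induction N using Nat.strong_induction_on with
    | _ N ih =>
      intro k hk
      by_cases h : (g k).1 ∈ p (g k).2
      · exact ⟨k, rfl, h⟩
      · have h1 : g (k + 1) = (t _ _ h, (g k).2) := by
          rw [hg]
          simp only [step, dif_neg h]
        obtain ⟨j, hj, hj'⟩ := ih (d (g (k + 1)).2 (g (k + 1)).1)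
          (by rw [h1, ← hk]; exact ht' _ _ h) (k + 1) rfl
        rw [h1] at hj hj'
        exact ⟨j, hj, hj'⟩
  have hall : ∀ m, ∃ j, (g j).2 = m ∧ (g j).1 ∈ p m := by
    intro m
    induction m with
    | zero => exact hvisit _ 0 rfl
    | succ m ih =>
      obtain ⟨j, hj, hj'⟩ := ih
      have h1 : (g (j + 1)).2 = m + 1 := by
        rw [hg]
        simp only [step]
        rw [dif_pos (by rw [hj]; exact hj'), hj]
      obtain ⟨i, hi⟩ := hvisit _ (j + 1) rfl
      rw [h1] at hi
      exact ⟨i, hi⟩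
  choose j hj hj' using hall
  exact ⟨fun k => (g k).1, hR, j, fun m n h => by rw [← hj m, ← hj n, h], hj'⟩

/-! ### Bounding the scores of Player 1 -/

/-- If Player 0 wins everywhere in a non-empty subgame `X` from the family `𝓕`, then she also wins
everywhere in a smaller non-empty subgame which Player 1 cannot leave: a winning strategy cannot
make all vertices of `X` reachable from all of its positions, since otherwise some play would visit
all of `X` infinitely often. -/
theorem exists_winnable_trap [Finite V] {A : Arena V} {𝓕 : Set (Set V)} {X : Set V}
    (hX𝓕 : X ∈ 𝓕) (hsucc : ∀ x ∈ X, ∃ v ∈ X, A.E x v) (hne : X.Nonempty)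
    (hwin : Winnable A 𝓕 X) :
    ∃ Y ⊂ X, Y.Nonempty ∧ Winnable A 𝓕 Y ∧
      ∀ y ∈ Y, y ∉ A.V0 → ∀ v ∈ X, A.E y v → v ∈ Y := by
  obtain ⟨x₀, hx₀⟩ := hne
  obtain ⟨T, ⟨hT, hinf⟩, w₀, hw₀, -⟩ := hwin x₀ hx₀
  let R : T → T → Prop := fun u u' => ∃ v, u'.1 = u.1 ++ [v]
  have hRsucc : ∀ u : T, ∃ u', R u u' := by
    rintro ⟨u, hu⟩
    obtain ⟨x, hx, -, h0, h1⟩ := hT u hu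
    by_cases hV : x ∈ A.V0
    · obtain ⟨v, -, -, hv⟩ := h0 hV
      exact ⟨⟨_, hv⟩, v, rfl⟩
    · obtain ⟨v, hv, hE⟩ := hsucc x hx
      exact ⟨⟨_, h1 hV v hv hE⟩, v, rfl⟩
  by_cases hall : ∀ u : T, ∀ x ∈ X, ∃ u' : T, u'.1.getLast? = some x ∧ Relation.ReflTransGen R u u'
  · exfalso
    have : Nonempty X := ⟨⟨x₀, hx₀⟩⟩
    obtain ⟨e, he⟩ := exists_surjective_nat X
    obtain ⟨f, hf, j, hj, hfj⟩ := exists_path_visiting R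
      (fun n => {u | u.1.getLast? = some (e n.unpair.1).1}) hRsucc
      (fun n u => hall u _ (e n.unpair.1).2) ⟨w₀, hw₀⟩
    choose r hr using hf
    refine hinf (fun n => (f n).1) r (fun n => (f n).2) hr ?_
    have hlast : ∀ n, (f (n + 1)).1.getLast? = some (r n) := fun n => by rw [hr n]; simp
    suffices h : infi r = X by rwa [h]
    apply Set.Subset.antisymm
    · intro x hx
      obtain ⟨n, hn⟩ := Set.Infinite.nonempty hx
      obtain ⟨y, hy, hly, -⟩ := hT _ (f (n + 1)).2
      rw [hlast n] at hly
      rw [← show r n = x from hn, Option.some.inj hly]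
      exact hy
    · intro x hx
      obtain ⟨i, hi⟩ := he ⟨x, hx⟩
      have h1 : {k | (f k).1.getLast? = some x}.Infinite := by
        refine Set.infinite_of_injective_forall_mem (f := fun n => j (Nat.pair i n)) ?_ ?_
        · intro m n hmn
          have := hj hmn
          simpa using this
        · intro n
          have := hfj (Nat.pair i n)
          simpa [hi] using this
      refine Set.infinite_of_not_bddAbove fun ⟨b, hb⟩ => ?_
      obtain ⟨k, hk, hbk⟩ := h1.exists_gt (b + 1)
      obtain ⟨k, rfl⟩ : ∃ k', k = k' + 1 := ⟨k - 1, by omega⟩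
      have hk' : r k = x := by
        rw [Set.mem_ofPred_eq, hlast k] at hk
        exact Option.some.inj hk
      have := hb hk'
      omega
  · push Not at hall
    obtain ⟨u, x, hx, hu⟩ := hall
    let T' : Set (List V) := {w | ∃ h : w ∈ T, Relation.ReflTransGen R u ⟨w, h⟩}
    let Y : Set V := {y | ∃ w ∈ T', w.getLast? = some y}
    have hstep : ∀ w ∈ T', ∀ v, w ++ [v] ∈ T → w ++ [v] ∈ T' :=
      fun w ⟨h, hw⟩ v hv => ⟨hv, hw.tail ⟨v, rfl⟩⟩
    have hYX : Y ⊆ X := by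
      rintro y ⟨w, ⟨hw, -⟩, hl⟩
      obtain ⟨y', hy', hl', -⟩ := hT w hw
      rw [hl] at hl'
      rwa [Option.some.inj hl']
    have htrap : ∀ y ∈ Y, y ∉ A.V0 → ∀ v ∈ X, A.E y v → v ∈ Y := by
      rintro y ⟨w, hw, hl⟩ hV v hv hE
      obtain ⟨y', -, hl', -, h1⟩ := hT w hw.1
      obtain rfl : y = y' := by rw [hl] at hl'; exact Option.some.inj hl'
      exact ⟨w ++ [v], hstep w hw v (h1 hV v hv hE), by simp⟩
    have hT' : WinTree A 𝓕 Y T' := by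
      refine ⟨fun w hw => ?_, fun f r hf hr => hinf f r (fun n => (hf n).1) hr⟩
      obtain ⟨y, -, hl, h0, h1⟩ := hT w hw.1
      have hy : y ∈ Y := ⟨w, hw, hl⟩
      refine ⟨y, hy, hl, fun hV => ?_, fun hV v hv hE => hstep w hw v (h1 hV v (hYX hv) hE)⟩
      obtain ⟨v, -, hE, hvT⟩ := h0 hV
      exact ⟨v, ⟨w ++ [v], hstep w hw v hvT, by simp⟩, hE, hstep w hw v hvT⟩
    refine ⟨Y, ⟨hYX, fun h => ?_⟩, ?_, fun y ⟨w, hw, hl⟩ => ⟨T', hT', w, hw, hl⟩, htrap⟩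
    · obtain ⟨w, ⟨hw, huw⟩, hl⟩ := h hx
      exact hu ⟨w, hw⟩ hl huw
    · obtain ⟨y, -, hl, -⟩ := hT u.1 u.2
      exact ⟨y, u.1, ⟨u.2, .refl⟩, hl⟩

/-- The induction step for a subgame `X` with a smaller subgame `Y` that Player 1 cannot leave:
outside of the attractor of `Y`, Player 0 bounds the scores by induction; in the attractor she
moves to `Y`; and in `Y` she again bounds the scores by induction. -/
theorem boundsScores_of_trap [Finite V] {A : Arena V} {𝓕 : Set (Set V)} {X Y : Set V}
    (hYX : Y ⊂ X) (hne : Y.Nonempty)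
    (htrap : ∀ y ∈ Y, y ∉ A.V0 → ∀ v ∈ X, A.E y v → v ∈ Y) (hwin : Winnable A 𝓕 X)
    (hY : BoundsScores A 𝓕 Y)
    (ih : ∀ Z ⊂ X, Winnable A 𝓕 Z → BoundsScores A 𝓕 Z) : BoundsScores A 𝓕 X := by
  obtain ⟨Z, rank, hZX, hZY, hZ0, hr0, hr1⟩ := exists_trap_and_rank A X Y
  have hZ : BoundsScores A 𝓕 Z := by
    refine ih Z ⟨hZX, fun h => ?_⟩ (hwin.of_trap hZX hZ0)
    obtain ⟨y, hy⟩ := hne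
    exact Set.disjoint_left.mp hZY (h (hYX.1 hy)) hy
  intro w₀ x₀ hl₀ hx₀ hb₀
  -- the play prefixes outside of the attractor (`Pa`), in the attractor (`Pb`) and in `Y` (`Pc`),
  -- with the invariants for the sets that are not covered by the induction hypothesis
  let Pa : Set (List V) := {u | ∃ x ∈ Z, u.getLast? = some x ∧ u ∈ Bounded A 𝓕 Z ∧
    ∀ F ∈ 𝓕, F ⊆ X → ¬ F ⊆ Z → score F u = 0 ∨ (score F u = 1 ∧ acc F u ⊆ Z)}
  let Pb : Set (List V) := {u | ∃ x ∈ X \ Z, x ∉ Y ∧ u.getLast? = some x ∧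
    ∀ F ∈ 𝓕, F ⊆ X → LacksAt {y | y ∉ Y ∧ rank x ≤ rank y} F u}
  let Pc : Set (List V) := {u | ∃ x ∈ Y, u.getLast? = some x ∧ u ∈ Bounded A 𝓕 Y ∧
    ∀ F ∈ 𝓕, F ⊆ X → ¬ F ⊆ Y → LacksAt Yᶜ F u}
  have hmissing : ∀ F : Set V, ¬ F ⊆ Y → (Yᶜ ∩ F).Nonempty := fun F hF => by
    obtain ⟨y, hy, hy'⟩ := Set.not_subset.mp hF
    exact ⟨y, hy', hy⟩
  have ha : ∀ u ∈ Pa, ∀ F ∈ 𝓕, F ⊆ X → ∀ v ∉ Z, v ∈ F → score F u ≤ 1 := by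
    rintro u ⟨x, -, -, -, h⟩ F hF hFX v hv hvF
    rcases h F hF hFX (fun h => hv (h hvF)) with h | h <;> omega
  have hab : ∀ u ∈ Pa, ∀ v ∈ X, v ∉ Z → u ++ [v] ∈ Pb ∪ Pc := by
    intro u hu v hv hvZ
    have hnotin : ∀ (F Q : Set V), F ∈ 𝓕 → F ⊆ X → (v ∈ F → (Q ∩ F).Nonempty) →
        LacksAt Q F (u ++ [v]) := by
      intro F Q hF hFX hQ
      by_cases hvF : v ∈ F
      · have h : LacksAt ∅ F u := Or.inl (ha u hu F hF hFX v hvZ hvF)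
        exact h.append (by simp) (Set.empty_subset _) hQ
      · exact Or.inl (by rw [(score_acc_append_of_notMem hvF u).1]; omega)
    by_cases hvY : v ∈ Y
    · right
      obtain ⟨x, hx, hl, -⟩ := hu
      exact ⟨v, hvY, by simp, hY _ v (by simp) hvY
        (burden_append hl (Set.disjoint_left.mp hZY hx) v),
        fun F hF hFX hFY => hnotin F _ hF hFX fun _ => hmissing F hFY⟩
    · left
      exact ⟨v, ⟨hv, hvZ⟩, hvY, by simp, fun F hF hFX => hnotin F _ hF hFX
        fun h => ⟨v, ⟨hvY, le_rfl⟩, h⟩⟩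
  have haa : ∀ u ∈ Pa, ∀ v ∈ Z, u ++ [v] ∈ Bounded A 𝓕 Z → u ++ [v] ∈ Pa := by
    rintro u ⟨x, -, -, -, h⟩ v hv hvB
    exact ⟨v, hv, by simp, hvB, fun F hF hFX hFZ => score_le_one_append hFZ (h F hF hFX hFZ) hv⟩
  have hbb : ∀ u ∈ Pb, ∀ x, u.getLast? = some x → ∀ v ∈ X \ Z, rank v < rank x →
      u ++ [v] ∈ Pb ∪ Pc := by
    rintro u ⟨x', hx', hxY, hl', h⟩ x hl v hv hr
    obtain rfl : x = x' := by rw [hl] at hl'; exact Option.some.inj hl'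
    by_cases hvY : v ∈ Y
    · exact Or.inr ⟨v, hvY, by simp, hY _ v (by simp) hvY (burden_append hl hxY v),
        fun F hF hFX hFY => (h F hF hFX).append (fun h => h.1 hvY) (fun y hy => hy.1)
          fun _ => hmissing F hFY⟩
    · exact Or.inl ⟨v, hv, hvY, by simp, fun F hF hFX => (h F hF hFX).append
        (fun h => by have : rank x ≤ rank v := h.2; omega) (fun y hy => ⟨hy.1, hr.le.trans hy.2⟩)
        fun hvF => ⟨v, ⟨hvY, le_rfl⟩, hvF⟩⟩
  have hcc : ∀ u ∈ Pc, ∀ v ∈ Y, u ++ [v] ∈ Bounded A 𝓕 Y → u ++ [v] ∈ Pc := by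
    rintro u ⟨x, -, -, -, h⟩ v hv hvB
    exact ⟨v, hv, by simp, hvB, fun F hF hFX hFY => (h F hF hFX hFY).append (fun h => h hv)
      subset_rfl fun _ => hmissing F hFY⟩
  refine ⟨Pa ∪ (Pb ∪ Pc), ?_, ?_, ?_⟩
  · rintro u (hu | hu | hu)
    · obtain ⟨x, hx, hl, h0, h1⟩ := closed_bounded A 𝓕 Z u hu.choose_spec.2.2.1
      refine ⟨x, hZX hx, hl, fun hV => ?_, fun hV v hv hE => ?_⟩
      · obtain ⟨v, hv, hE, hvB⟩ := h0 hV
        exact ⟨v, hZX hv, hE, Or.inl (haa u hu v hv hvB)⟩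
      · by_cases hvZ : v ∈ Z
        · exact Or.inl (haa u hu v hvZ (h1 hV v hvZ hE))
        · exact Or.inr (hab u hu v hv hvZ)
    · obtain ⟨x, hx, hxY, hl, -⟩ := id hu
      refine ⟨x, hx.1, hl, fun hV => ?_, fun hV v hv hE => ?_⟩
      · obtain ⟨v, hv, hE, hr⟩ := hr0 x hx hxY hV
        exact ⟨v, hv.1, hE, Or.inr (hbb u hu x hl v hv hr)⟩
      · obtain ⟨hvZ, hr⟩ := hr1 x hx hxY hV v hv hE
        exact Or.inr (hbb u hu x hl v ⟨hv, hvZ⟩ hr)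
    · obtain ⟨x, hx, hl, h0, h1⟩ := closed_bounded A 𝓕 Y u hu.choose_spec.2.2.1
      refine ⟨x, hYX.1 hx, hl, fun hV => ?_, fun hV v hv hE => ?_⟩
      · obtain ⟨v, hv, hE, hvB⟩ := h0 hV
        exact ⟨v, hYX.1 hv, hE, Or.inr (Or.inr (hcc u hu v hv hvB))⟩
      · have hvY := htrap x hx hV v hv hE
        exact Or.inr (Or.inr (hcc u hu v hvY (h1 hV v hvY hE)))
  · by_cases hxZ : x₀ ∈ Z
    · exact Or.inl ⟨x₀, hxZ, hl₀, hZ w₀ x₀ hl₀ hxZ (hb₀.mono hZX), fun F hF hFX _ =>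
        (hb₀ F hF hFX).imp id fun h => ⟨h.1, by simp [h.2]⟩⟩
    · have h1 : ∀ (F Q : Set V), F ∈ 𝓕 → F ⊆ X → LacksAt Q F w₀ := fun F Q hF hFX =>
        Or.inl (by rcases hb₀ F hF hFX with h | h <;> omega)
      by_cases hxY : x₀ ∈ Y
      · exact Or.inr (Or.inr ⟨x₀, hxY, hl₀, hY w₀ x₀ hl₀ hxY (hb₀.mono hYX.1),
          fun F hF hFX _ => h1 F _ hF hFX⟩)
      · exact Or.inr (Or.inl ⟨x₀, ⟨hx₀, hxZ⟩, hxY, hl₀, fun F hF hFX => h1 F _ hF hFX⟩)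
  · rintro u (⟨x, hx, hl, hB, h⟩ | ⟨x, hx, hxY, hl, h⟩ | ⟨x, hx, hl, hB, h⟩) F hF hFX
    · by_cases hFZ : F ⊆ Z
      · exact score_le_two_of_mem_bounded hB hF hFZ
      · rcases h F hF hFX hFZ with h | h <;> omega
    · exact (h F hF hFX).score_le_two
    · by_cases hFY : F ⊆ Y
      · exact score_le_two_of_mem_bounded hB hF hFY
      · exact (h F hF hFX hFY).score_le_two

/-- The induction step for a subgame `X` that does not belong to the family: whenever the play
has produced a burden, Player 0 picks a set `C` from the family which covers the longest suffix of
the play prefix that can be covered at all. Outside of the attractor of `X \ C` she bounds the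
scores by induction, and in the attractor she moves to `X \ C`, where the play prefix again is a
burden. -/
theorem boundsScores_of_notMem [Finite V] {A : Arena V} {𝓕 : Set (Set V)} {X : Set V}
    (hX : X ∉ 𝓕) (hwin : Winnable A 𝓕 X)
    (ih : ∀ Z ⊂ X, Winnable A 𝓕 Z → BoundsScores A 𝓕 Z) : BoundsScores A 𝓕 X := by
  choose Z rank hZX hZC hZ0 hr0 hr1 using fun C => exists_trap_and_rank A X (X \ C)
  have hZC' : ∀ C, Z C ⊆ C := fun C x hx => by
    by_contra h
    exact Set.disjoint_left.mp (hZC C) hx ⟨hZX C hx, h⟩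
  have hZ : ∀ C ∈ 𝓕, C ⊆ X → BoundsScores A 𝓕 (Z C) := by
    refine fun C hC hCX => ih _ ⟨hZX C, fun h => ?_⟩ (hwin.of_trap (hZX C) (hZ0 C))
    exact hX ((hCX.antisymm (h.trans (hZC' C))) ▸ hC)
  -- the play prefixes at which `C` is chosen (`P0`), and, for a fixed choice of `C`, those outside
  -- of the attractor of `X \ C` (`Pa`) and those in the attractor (`Pb`)
  let P0 : Set (List V) := {u | ∃ x ∈ X, u.getLast? = some x ∧ Burden 𝓕 X u}
  let Pa : Set V → Set (List V) := fun C => {u | ∃ x ∈ Z C, u.getLast? = some x ∧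
    u ∈ Bounded A 𝓕 (Z C) ∧
    (∀ F ∈ 𝓕, F ⊆ C → ¬ F ⊆ Z C → score F u = 0 ∨ (score F u = 1 ∧ acc F u ⊆ Z C)) ∧
    (∀ F ∈ 𝓕, F ⊆ X → ¬ F ⊆ C → score F u = 0 ∧ acc F u ⊆ C)}
  let Pb : Set V → Set (List V) := fun C => {u | ∃ x ∈ X \ Z C, x ∈ C ∧ u.getLast? = some x ∧
    (∀ F ∈ 𝓕, F ⊆ C → LacksAt {y | rank C x ≤ rank C y} F u) ∧
    (∀ F ∈ 𝓕, F ⊆ X → ¬ F ⊆ C → score F u = 0 ∧ acc F u ⊆ C)}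
  -- leaving `C` turns the play prefix into a burden
  have hexit : ∀ (C : Set V) (u : List V),
      (∀ F ∈ 𝓕, F ⊆ X → ¬ F ⊆ C → score F u = 0 ∧ acc F u ⊆ C) →
      ∀ v ∈ X, v ∉ C → u ++ [v] ∈ P0 := by
    refine fun C u h v hv hvC => ⟨v, hv, by simp, fun F hF hFX => ?_⟩
    by_cases hFC : F ⊆ C
    · exact Or.inl (score_acc_append_of_notMem (fun h => hvC (hFC h)) u).1
    · exact score_append_of_score_eq_zero (h F hF hFX hFC).1 v
  have haa : ∀ C, ∀ u ∈ Pa C, ∀ v ∈ Z C, u ++ [v] ∈ Bounded A 𝓕 (Z C) → u ++ [v] ∈ Pa C := by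
    rintro C u ⟨x, -, -, -, h, h'⟩ v hv hvB
    exact ⟨v, hv, by simp, hvB, fun F hF hFC hFZ => score_le_one_append hFZ (h F hF hFC hFZ) hv,
      fun F hF hFX hFC => score_zero_acc_subset_append hFC (h' F hF hFX hFC) (hZC' C hv)⟩
  have hab : ∀ C, ∀ u ∈ Pa C, ∀ v ∈ X, v ∉ Z C → u ++ [v] ∈ P0 ∪ Pb C := by
    rintro C u ⟨x, hx, hl, hB, h, h'⟩ v hv hvZ
    by_cases hvC : v ∈ C
    · refine Or.inr ⟨v, ⟨hv, hvZ⟩, hvC, by simp, fun F hF hFC => ?_, fun F hF hFX hFC =>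
        score_zero_acc_subset_append hFC (h' F hF hFX hFC) hvC⟩
      by_cases hvF : v ∈ F
      · have h1 : LacksAt ∅ F u := Or.inl (by
          rcases h F hF hFC (fun h => hvZ (h hvF)) with h | h <;> omega)
        exact h1.append (by simp) (Set.empty_subset _) fun _ => ⟨v, by simp, hvF⟩
      · exact Or.inl (by rw [(score_acc_append_of_notMem hvF u).1]; omega)
    · exact Or.inl (hexit C u h' v hv hvC)
  have hbb : ∀ C, ∀ u ∈ Pb C, ∀ x, u.getLast? = some x → ∀ v ∈ X \ Z C, rank C v < rank C x →
      u ++ [v] ∈ P0 ∪ Pb C := by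
    rintro C u ⟨x', hx', hxC, hl', h, h'⟩ x hl v hv hr
    obtain rfl : x = x' := by rw [hl] at hl'; exact Option.some.inj hl'
    by_cases hvC : v ∈ C
    · refine Or.inr ⟨v, hv, hvC, by simp, fun F hF hFC => (h F hF hFC).append ?_ ?_ ?_,
        fun F hF hFX hFC => score_zero_acc_subset_append hFC (h' F hF hFX hFC) hvC⟩
      · intro (h : rank C x ≤ rank C v)
        omega
      · exact fun y hy => hr.le.trans hy
      · exact fun hvF => ⟨v, by simp, hvF⟩
    · exact Or.inl (hexit C u h' v hv.1 hvC)
  -- the choice of `C`, unless the last vertex belongs to no set of the family inside `X`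
  have hchoose : ∀ u ∈ P0, (∃ C ∈ 𝓕, C ⊆ X ∧ u ∈ Pa C ∪ Pb C) ∨ ∀ v, Burden 𝓕 X (u ++ [v]) := by
    rintro u ⟨x, hx, hl, hb⟩
    by_cases hx𝓕 : ∃ F ∈ 𝓕, F ⊆ X ∧ x ∈ F
    · left
      obtain ⟨F₀, hF₀, hF₀X, hxF₀⟩ := hx𝓕
      obtain ⟨C, ⟨hC, hCX⟩, hCs, hCr⟩ := exists_score_eq_zero_of_not_subset
        (𝓖 := {F ∈ 𝓕 | F ⊆ X}) ⟨F₀, hF₀, hF₀X⟩ u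
      have hxC : x ∈ C := by
        obtain ⟨u', rfl⟩ := List.getLast?_eq_some_iff.mp hl
        refine reached_subset C _ (hCr F₀ ⟨hF₀, hF₀X⟩ ?_)
        rw [reached_append_of_mem hxF₀]
        exact Or.inr rfl
      refine ⟨C, hC, hCX, ?_⟩
      have h' : ∀ F ∈ 𝓕, F ⊆ X → ¬ F ⊆ C → score F u = 0 ∧ acc F u ⊆ C :=
        fun F hF hFX hFC => hCs F ⟨hF, hFX⟩ hFC
      by_cases hxZ : x ∈ Z C
      · exact Or.inl ⟨x, hxZ, hl, hZ C hC hCX u x hl hxZ (hb.mono (hZX C)), fun F hF hFC _ =>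
          (hb F hF (hFC.trans hCX)).imp id fun h => ⟨h.1, by simp [h.2]⟩, h'⟩
      · exact Or.inr ⟨x, ⟨hx, hxZ⟩, hxC, hl, fun F hF hFC => Or.inl (by
          rcases hb F hF (hFC.trans hCX) with h | h <;> omega), h'⟩
    · right
      intro v F hF hFX
      exact score_append_of_score_eq_zero
        (score_acc_of_getLast?_notMem hl fun h => hx𝓕 ⟨F, hF, hFX, h⟩).1 v
  have hab_closed : ∀ C, ∀ u ∈ Pa C ∪ Pb C, ∃ x ∈ X, u.getLast? = some x ∧
      (x ∈ A.V0 → ∃ v ∈ X, A.E x v ∧ u ++ [v] ∈ P0 ∪ (Pa C ∪ Pb C)) ∧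
      (x ∉ A.V0 → ∀ v ∈ X, A.E x v → u ++ [v] ∈ P0 ∪ (Pa C ∪ Pb C)) := by
    rintro C u (hu | hu)
    · obtain ⟨x, hx, hl, h0, h1⟩ := closed_bounded A 𝓕 (Z C) u hu.choose_spec.2.2.1
      refine ⟨x, hZX C hx, hl, fun hV => ?_, fun hV v hv hE => ?_⟩
      · obtain ⟨v, hv, hE, hvB⟩ := h0 hV
        exact ⟨v, hZX C hv, hE, Or.inr (Or.inl (haa C u hu v hv hvB))⟩
      · by_cases hvZ : v ∈ Z C
        · exact Or.inr (Or.inl (haa C u hu v hvZ (h1 hV v hvZ hE)))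
        · exact (hab C u hu v hv hvZ).imp id Or.inr
    · obtain ⟨x, hx, hxC, hl, -⟩ := id hu
      have hxT : x ∉ X \ C := fun h => h.2 hxC
      refine ⟨x, hx.1, hl, fun hV => ?_, fun hV v hv hE => ?_⟩
      · obtain ⟨v, hv, hE, hr⟩ := hr0 C x hx hxT hV
        exact ⟨v, hv.1, hE, (hbb C u hu x hl v hv hr).imp id Or.inr⟩
      · obtain ⟨hvZ, hr⟩ := hr1 C x hx hxT hV v hv hE
        exact (hbb C u hu x hl v ⟨hv, hvZ⟩ hr).imp id Or.inr
  intro w₀ x₀ hl₀ hx₀ hb₀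
  refine ⟨P0 ∪ {u | ∃ C ∈ 𝓕, C ⊆ X ∧ u ∈ Pa C ∪ Pb C}, ?_, Or.inl ⟨x₀, hx₀, hl₀, hb₀⟩, ?_⟩
  · have hC_closed : ∀ u, (∃ C ∈ 𝓕, C ⊆ X ∧ u ∈ Pa C ∪ Pb C) → ∃ x ∈ X, u.getLast? = some x ∧
        (x ∈ A.V0 → ∃ v ∈ X, A.E x v ∧
          u ++ [v] ∈ P0 ∪ {u | ∃ C ∈ 𝓕, C ⊆ X ∧ u ∈ Pa C ∪ Pb C}) ∧
        (x ∉ A.V0 → ∀ v ∈ X, A.E x v →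
          u ++ [v] ∈ P0 ∪ {u | ∃ C ∈ 𝓕, C ⊆ X ∧ u ∈ Pa C ∪ Pb C}) := by
      rintro u ⟨C, hC, hCX, hu⟩
      obtain ⟨x, hx, hl, h0, h1⟩ := hab_closed C u hu
      refine ⟨x, hx, hl, fun hV => ?_, fun hV v hv hE =>
        (h1 hV v hv hE).imp id fun h => ⟨C, hC, hCX, h⟩⟩
      obtain ⟨v, hv, hE, h⟩ := h0 hV
      exact ⟨v, hv, hE, h.imp id fun h => ⟨C, hC, hCX, h⟩⟩
    rintro u (hu | hu)
    · rcases hchoose u hu with h | h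
      · exact hC_closed u h
      · obtain ⟨x, hx, hl, -⟩ := hu
        refine ⟨x, hx, hl, fun hV => ?_, fun hV v hv hE => Or.inl ⟨v, hv, by simp, h v⟩⟩
        obtain ⟨T, ⟨hT, -⟩, w, hw, hlw⟩ := hwin x hx
        obtain ⟨x', -, hl', h0, -⟩ := hT w hw
        obtain rfl : x = x' := by rw [hlw] at hl'; exact Option.some.inj hl'
        obtain ⟨v, hv, hE, -⟩ := h0 hV
        exact ⟨v, hv, hE, Or.inl ⟨v, hv, by simp, h v⟩⟩
    · exact hC_closed u hu
  · rintro u (⟨x, hx, hl, hb⟩ | ⟨C, hC, hCX, hu⟩) F hF hFX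
    · rcases hb F hF hFX with h | h <;> omega
    · rcases hu with ⟨x, hx, hl, hB, h, h'⟩ | ⟨x, hx, hxC, hl, h, h'⟩ <;> by_cases hFC : F ⊆ C
      · by_cases hFZ : F ⊆ Z C
        · exact score_le_two_of_mem_bounded hB hF hFZ
        · rcases h F hF hFC hFZ with h | h <;> omega
      · have := (h' F hF hFX hFC).1
        omega
      · exact (h F hF hFC).score_le_two
      · have := (h' F hF hFX hFC).1
        omega

/-- In a subgame in which Player 0 wins everywhere, she can bound the scores by 2. -/
theorem boundsScores_of_winnable [Finite V] {A : Arena V} {𝓕 : Set (Set V)}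
    (h𝓕 : ∀ F ∈ 𝓕, ∀ x ∈ F, ∃ v ∈ F, A.E x v) (X : Set V) (hwin : Winnable A 𝓕 X) :
    BoundsScores A 𝓕 X := by
  induction X using WellFoundedLT.induction with
  | ind X ih =>
    by_cases hX : X ∈ 𝓕
    · rcases X.eq_empty_or_nonempty with rfl | hne
      · exact fun _ _ _ h => absurd h (Set.notMem_empty _)
      · obtain ⟨Y, hYX, hYne, hY, htrap⟩ := exists_winnable_trap hX (h𝓕 X hX) hne hwin
        exact boundsScores_of_trap hYX hYne htrap hwin (ih Y hYX hY) ih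
    · exact boundsScores_of_notMem hX hwin ih

/-! ### Infinite plays -/

theorem before_succ (ρ : ℕ → V) (n : ℕ) : before ρ (n + 1) = before ρ n ++ [ρ n] := by
  simp [before, List.range_succ]

theorem infi_nonempty [Finite V] (ρ : ℕ → V) : (infi ρ).Nonempty := by
  obtain ⟨v, hv⟩ := Finite.exists_infinite_fiber ρ
  exact ⟨v, Set.infinite_coe_iff.mp hv⟩

theorem eventually_mem_infi [Finite V] (ρ : ℕ → V) : ∃ N, ∀ n ≥ N, ρ n ∈ infi ρ := by
  have h : {n | ρ n ∉ infi ρ}.Finite := by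
    have : {n | ρ n ∉ infi ρ} = ⋃ v ∈ (infi ρ)ᶜ, {n | ρ n = v} := by
      ext n
      simp
    rw [this]
    exact (Set.toFinite _).biUnion fun v hv => Set.not_infinite.mp hv
  obtain ⟨N, hN⟩ := h.bddAbove
  refine ⟨N + 1, fun n hn => ?_⟩
  by_contra h
  have : n ≤ N := hN h
  omega

theorem isLoop_infi {A : Arena V} {ρ : ℕ → V} (hρ : A.IsPlay ρ) : A.IsLoop (infi ρ) := by
  have := A.finite
  refine ⟨infi_nonempty ρ, fun v hv v' hv' => ?_⟩
  obtain ⟨N, hN⟩ := eventually_mem_infi ρ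
  obtain ⟨i, hi, hNi⟩ := Set.Infinite.exists_gt hv N
  obtain ⟨j, hj, hij⟩ := Set.Infinite.exists_gt hv' i
  have key : ∀ d, Relation.TransGen (fun a b => a ∈ infi ρ ∧ b ∈ infi ρ ∧ A.E a b) (ρ i)
      (ρ (i + d + 1)) := by
    intro d
    induction d with
    | zero => exact .single ⟨hN _ hNi.le, hN _ (by omega), hρ i⟩
    | succ d ih => exact ih.tail ⟨hN _ (by omega), hN _ (by omega), hρ _⟩
  have := key (j - i - 1)
  rwa [show i + (j - i - 1) + 1 = j by omega, show ρ i = v from hi, show ρ j = v' from hj] at this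

/-- The score of the set of infinitely often visited vertices tends to infinity. -/
theorem exists_score_infi_ge [Finite V] (ρ : ℕ → V) (k : ℕ) :
    ∃ n, k ≤ score (infi ρ) (before ρ n) := by
  obtain ⟨N, hN⟩ := eventually_mem_infi ρ
  have hstep : ∀ n ≥ N, (score (infi ρ) (before ρ (n + 1)) = score (infi ρ) (before ρ n) + 1) ∨
      (score (infi ρ) (before ρ (n + 1)) = score (infi ρ) (before ρ n) ∧
        acc (infi ρ) (before ρ (n + 1)) = acc (infi ρ) (before ρ n) ∪ {ρ n}) := by
    intro n hn
    rw [before_succ]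
    rcases score_acc_append_cases (infi ρ) (before ρ n) (ρ n) with h | h | h
    · exact absurd (hN n hn) h.1
    · exact Or.inl h.2.2.1
    · exact Or.inr h.2.2
  have hmono : ∀ n ≥ N, ∀ d,
      score (infi ρ) (before ρ n) ≤ score (infi ρ) (before ρ (n + d)) := by
    intro n hn d
    induction d with
    | zero => exact le_rfl
    | succ d ih => rcases hstep (n + d) (by omega) with h | h <;> rw [← add_assoc] <;> omega
  have hinc : ∀ n ≥ N, ∃ d, score (infi ρ) (before ρ n) < score (infi ρ) (before ρ (n + d)) := by
    intro n hn
    by_contra! hcon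
    -- without an increment the accumulator collects all of `infi ρ`
    have hacc : ∀ d, ∀ i < d, ρ (n + i) ∈ acc (infi ρ) (before ρ (n + d)) := by
      intro d
      induction d with
      | zero => intro i hi; omega
      | succ d ih =>
        intro i hi
        have h1 := hcon (d + 1)
        have h2 := hmono n hn d
        rcases hstep (n + d) (by omega) with h | h
        · rw [← add_assoc] at h1
          omega
        · rw [← add_assoc, h.2]
          rcases (by omega : i < d ∨ i = d) with h | rfl
          · exact Or.inl (ih i h)
          · exact Or.inr rfl
    have hall : ∀ v ∈ infi ρ, ∃ d, ∀ e ≥ d, v ∈ acc (infi ρ) (before ρ (n + e)) := by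
      intro v hv
      obtain ⟨i, hi, hni⟩ := Set.Infinite.exists_gt hv n
      refine ⟨i - n + 1, fun e he => ?_⟩
      have := hacc e (i - n) (by omega)
      rwa [show n + (i - n) = i by omega, show ρ i = v from hi] at this
    choose! d hd using hall
    obtain ⟨D, hD⟩ := (Set.toFinite (d '' infi ρ)).bddAbove
    refine acc_ne (infi_nonempty ρ) (before ρ (n + D)) (Set.Subset.antisymm (acc_subset _ _) ?_)
    exact fun v hv => hd v hv D (hD ⟨v, hv, rfl⟩)
  suffices h : ∃ n ≥ N, k ≤ score (infi ρ) (before ρ n) from h.imp fun _ h => h.2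
  induction k with
  | zero => exact ⟨N, le_rfl, by omega⟩
  | succ k ih =>
    obtain ⟨n, hn, hk⟩ := ih
    obtain ⟨d, hd⟩ := hinc n hn
    exact ⟨n + d, by omega, by omega⟩

/-! ### Positional strategies -/

open scoped Classical in
/-- The positional strategy that moves along `f` wherever `f` follows an edge. -/
noncomputable def positional (A : Arena V) (f : V → V) : Strategy A where
  move _ v := if A.E v (f v) then f v else (A.total v).choose
  valid _ v _ := by
    split_ifs with h
    · exact h
    · exact (A.total v).choose_spec

theorem isPositional_positional (A : Arena V) (f : V → V) : (positional A f).IsPositional :=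
  fun _ _ _ => rfl

/-- In a safety game, Player 0 has a positional winning strategy from every set of safe vertices
that she can refuse to leave. -/
theorem exists_positional_winsFrom {A : Arena V} {F W : Set V} (hWF : W ⊆ F)
    (h0 : ∀ a ∈ W, a ∈ A.V0 → ∃ b ∈ W, A.E a b) (h1 : ∀ a ∈ W, a ∉ A.V0 → ∀ b, A.E a b → b ∈ W) :
    ∃ τ : Strategy A, τ.IsPositional ∧ (safetyGame A F).WinsFrom τ W := by
  classical
  have h : ∀ a, ∃ b, a ∈ W → a ∈ A.V0 → b ∈ W ∧ A.E a b := fun a => by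
    by_cases ha : a ∈ W ∧ a ∈ A.V0
    · obtain ⟨b, hb⟩ := h0 a ha.1 ha.2
      exact ⟨b, fun _ _ => hb⟩
    · exact ⟨a, fun h h' => absurd ⟨h, h'⟩ ha⟩
  choose f hf using h
  refine ⟨positional A f, isPositional_positional A f, ?_⟩
  rintro v hv ρ ⟨hplay, rfl, hcons⟩ a ⟨n, rfl⟩
  apply hWF
  induction n with
  | zero => exact hv
  | succ n ih =>
    by_cases hV : ρ n ∈ A.V0
    · have := hcons n hV
      simp only [positional, if_pos (hf _ ih hV).2] at this
      rw [this]
      exact (hf _ ih hV).1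
    · exact h1 _ ih hV _ (hplay n)

/-- The strategy after a first move from `a`. -/
def Strategy.shift {A : Arena V} (σ : Strategy A) (a : V) : Strategy A where
  move w v := σ.move (a :: w) v
  valid w v hv := σ.valid (a :: w) v hv

theorem before_cons (a : V) (ρ : ℕ → V) (n : ℕ) :
    before (fun k => Nat.casesOn k a ρ : ℕ → V) (n + 1) = a :: before ρ n := by
  simp [before, List.range_succ_eq_map, Function.comp_def]

/-- Prepending a consistent move to a play. -/
theorem Strategy.cons_mem_Beh {A : Arena V} {σ : Strategy A} {a b : V} (hE : A.E a b)
    (hσ : a ∈ A.V0 → b = σ.move [] a) {ρ : ℕ → V} (hρ : ρ ∈ (σ.shift a).Beh b) :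
    (fun k => Nat.casesOn k a ρ : ℕ → V) ∈ σ.Beh a := by
  obtain ⟨hplay, h0, hcons⟩ := hρ
  refine ⟨fun n => ?_, rfl, fun n => ?_⟩
  · rcases n with _ | n
    · show A.E a (ρ 0)
      rwa [h0]
    · exact hplay n
  · rcases n with _ | n
    · intro h
      show ρ 0 = σ.move [] a
      rw [h0, hσ h]
    · intro h
      rw [before_cons]
      exact hcons n h

theorem safetyGame_W0_succ {A : Arena V} {F : Set V} {a : V} (ha : a ∈ (safetyGame A F).W0) :
    (a ∈ A.V0 → ∃ b ∈ (safetyGame A F).W0, A.E a b) ∧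
      (a ∉ A.V0 → ∀ b, A.E a b → b ∈ (safetyGame A F).W0) := by
  obtain ⟨σ, hσ⟩ := ha
  have key : ∀ b, A.E a b → (a ∈ A.V0 → b = Strategy.move σ [] a) → b ∈ (safetyGame A F).W0 := by
    refine fun b hE hb => ⟨Strategy.shift σ a, ?_⟩
    rintro _ rfl ρ hρ _ ⟨n, rfl⟩
    exact hσ a rfl _ (Strategy.cons_mem_Beh hE hb hρ) ⟨n + 1, rfl⟩
  refine ⟨fun hV => ?_, fun hV b hE => key b hE fun h => absurd h hV⟩
  exact ⟨_, key _ (Strategy.valid σ [] a hV) fun _ => rfl, Strategy.valid σ [] a hV⟩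

theorem Strategy.IsPositional.mem_Beh {A : Arena V} {τ : Strategy A} (hτ : τ.IsPositional) {v : V}
    {ρ : ℕ → V} : ρ ∈ τ.Beh v ↔ A.IsPlay ρ ∧ ρ 0 = v ∧
      ∀ n, ρ n ∈ A.V0 → ρ (n + 1) = τ.move [] (ρ n) := by
  unfold Strategy.Beh
  refine and_congr_right fun _ => and_congr_right fun _ => forall_congr' fun n =>
    forall_congr' fun h => ?_
  rw [hτ _ _ h]

theorem Strategy.IsPositional.shift_Beh {A : Arena V} {τ : Strategy A} (hτ : τ.IsPositional)
    (a v : V) : (τ.shift a).Beh v = τ.Beh v := by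
  have hτ' : (τ.shift a).IsPositional := fun w v hv =>
    (hτ (a :: w) v hv).trans (hτ [a] v hv).symm
  ext ρ
  rw [hτ.mem_Beh, hτ'.mem_Beh]
  refine and_congr_right fun _ => and_congr_right fun _ => forall_congr' fun n =>
    forall_congr' fun h => ?_
  rw [show (τ.shift a).move [] (ρ n) = τ.move [] (ρ n) from hτ [a] _ h]

theorem Strategy.IsPositional.Beh_nonempty {A : Arena V} {τ : Strategy A} (hτ : τ.IsPositional)
    (v : V) : (τ.Beh v).Nonempty := by
  classical
  let f : V → V := fun a => if a ∈ A.V0 then τ.move [] a else (A.total a).choose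
  refine ⟨fun n => f^[n] v, hτ.mem_Beh.mpr ⟨fun n => ?_, rfl, fun n h => ?_⟩⟩
  · simp only [Function.iterate_succ_apply']
    by_cases h : f^[n] v ∈ A.V0
    · rw [show f (f^[n] v) = τ.move [] (f^[n] v) from if_pos h]
      exact τ.valid _ _ h
    · rw [show f (f^[n] v) = (A.total (f^[n] v)).choose from if_neg h]
      exact (A.total _).choose_spec
  · simp only [Function.iterate_succ_apply']
    exact if_pos h

/-- A play that is consistent with a positional strategy can be continued by any consistent play
from the vertex reached. -/
theorem Strategy.IsPositional.splice {A : Arena V} {τ : Strategy A} (hτ : τ.IsPositional) {v : V}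
    {ρ ρ' : ℕ → V} (hρ : ρ ∈ τ.Beh v) (n : ℕ) (hρ' : ρ' ∈ τ.Beh (ρ n)) :
    (fun k => if k < n then ρ k else ρ' (k - n)) ∈ τ.Beh v := by
  rw [hτ.mem_Beh] at *
  obtain ⟨hp, h0, hc⟩ := hρ
  obtain ⟨hp', h0', hc'⟩ := hρ'
  have hnext : ∀ k, ∃ i, (k < n ∧ i = k ∧ (if k < n then ρ k else ρ' (k - n)) = ρ k ∧
      (if k + 1 < n then ρ (k + 1) else ρ' (k + 1 - n)) = ρ (k + 1)) ∨
      (n ≤ k ∧ i = k - n ∧ (if k < n then ρ k else ρ' (k - n)) = ρ' i ∧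
      (if k + 1 < n then ρ (k + 1) else ρ' (k + 1 - n)) = ρ' (i + 1)) := by
    intro k
    rcases lt_or_ge k n with h | h
    · refine ⟨k, Or.inl ⟨h, rfl, if_pos h, ?_⟩⟩
      rcases (by omega : k + 1 < n ∨ k + 1 = n) with h' | h'
      · exact if_pos h'
      · rw [if_neg (by omega), h', Nat.sub_self, h0']
    · refine ⟨k - n, Or.inr ⟨h, rfl, if_neg (by omega), ?_⟩⟩
      rw [if_neg (by omega), show k + 1 - n = k - n + 1 by omega]
  refine ⟨fun k => ?_, ?_, fun k => ?_⟩
  · obtain ⟨i, ⟨-, -, h1, h2⟩ | ⟨-, -, h1, h2⟩⟩ := hnext k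
    · simp only [h1, h2]
      exact hp k
    · simp only [h1, h2]
      exact hp' i
  · rcases Nat.eq_zero_or_pos n with rfl | h
    · simp [h0', h0]
    · simp [h, h0]
  · obtain ⟨i, ⟨-, -, h1, h2⟩ | ⟨-, -, h1, h2⟩⟩ := hnext k
    · simp only [h1, h2]
      exact hc k
    · simp only [h1, h2]
      exact hc' i

/-! ### The play prefixes of a strategy -/

/-- The play prefixes that start in `v` and are consistent with `σ`. -/
def Strategy.prefixes {A : Arena V} (σ : Strategy A) (v : V) : Set (List V) :=
  {w | w.head? = some v ∧ w.IsChain A.E ∧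
    ∀ u x y, u ++ [x, y] <+: w → x ∈ A.V0 → y = σ.move u x}

theorem Strategy.append_mem_prefixes {A : Arena V} {σ : Strategy A}
    {v x y : V} {w : List V} (hw : w ∈ σ.prefixes v) (hl : w.getLast? = some x) (hE : A.E x y)
    (hσ : x ∈ A.V0 → y = σ.move w.dropLast x) : w ++ [y] ∈ σ.prefixes v := by
  obtain ⟨h1, h2, h3⟩ := hw
  refine ⟨by simp [List.head?_append, h1], ?_, fun u x' y' hu hx' => ?_⟩
  · rw [List.isChain_append]
    refine ⟨h2, by simp, fun a ha b hb => ?_⟩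
    rw [hl, Option.mem_some_iff] at ha
    simp only [List.head?_cons, Option.mem_some_iff] at hb
    exact ha ▸ hb ▸ hE
  · rcases List.prefix_concat_iff.mp hu with h | h
    · rw [show u ++ [x', y'] = (u ++ [x']) ++ [y'] by simp] at h
      obtain ⟨rfl, h⟩ := List.append_inj' h rfl
      obtain rfl : y' = y := by simpa using h
      obtain rfl : x' = x := by simpa using hl
      simpa using hσ hx'
    · exact h3 u x' y' h hx'

theorem infi_shift (ρ : ℕ → V) (L : ℕ) : infi (fun n => ρ (L + n)) = infi ρ := by
  ext v
  constructor
  · intro h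
    refine (Set.Infinite.image (f := fun n => L + n) (fun m _ n _ => Nat.add_left_cancel) h).mono ?_
    rintro _ ⟨n, hn, rfl⟩
    exact hn
  · intro h
    refine Set.infinite_of_not_bddAbove fun ⟨b, hb⟩ => ?_
    obtain ⟨k, hk, hbk⟩ := Set.Infinite.exists_gt h (L + b)
    have := hb (show ρ (L + (k - L)) = v by rw [show L + (k - L) = k by omega]; exact hk)
    omega

/-- An infinite branch through the prefixes of consistent plays is a tail of a consistent play. -/
theorem Strategy.exists_play_of_prefixes {A : Arena V} {σ : Strategy A} {v : V}
    {w : ℕ → List V} {r : ℕ → V} (hw : ∀ n, w n ∈ σ.prefixes v)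
    (hr : ∀ n, w (n + 1) = w n ++ [r n]) : ∃ ρ ∈ σ.Beh v, infi ρ = infi r := by
  let L := (w 0).length
  let ρ : ℕ → V := fun k => if k < L then (w 0).getD k v else r (k - L)
  have hρr : ∀ n, ρ (L + n) = r n := fun n => by simp [ρ]
  have hρ : ∀ n, before ρ (L + n) = w n := by
    intro n
    induction n with
    | zero =>
      refine List.ext_getElem (by simp [before, L]) fun i h1 h2 => ?_
      have h3 : i < L := h2
      simp [before, ρ, h3, h2]
    | succ n ih => rw [← add_assoc, before_succ, ih, hρr, hr]
  have hpre : ∀ k, before ρ k ++ [ρ k, ρ (k + 1)] <+: w (k + 2) := by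
    intro k
    have h1 : before ρ k ++ [ρ k, ρ (k + 1)] = before ρ (k + 2) := by
      simp [before_succ]
    have h2 : ∀ m d, before ρ m <+: before ρ (m + d) := by
      intro m d
      induction d with
      | zero => exact List.prefix_rfl
      | succ d ih =>
        rw [← add_assoc, before_succ]
        exact ih.trans (List.prefix_append _ _)
    rw [h1, ← hρ, add_comm L]
    exact h2 _ _
  refine ⟨ρ, ⟨fun k => ?_, ?_, fun k hk => (hw (k + 2)).2.2 _ _ _ (hpre k) hk⟩, ?_⟩
  · have h := ((hw (k + 2)).2.1.prefix (hpre k))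
    rw [List.isChain_append] at h
    simpa using h.2.1
  · obtain ⟨t, ht⟩ := hpre 0
    have h := (hw 2).1
    simpa [← ht, before] using h
  · rw [← infi_shift ρ L]
    exact congrArg infi (funext hρr)

/-! ### The safety game -/

namespace MullerGame

theorem nonempty_of_mem_F1 {G : MullerGame V} {F : Set V} (hF : F ∈ G.F1) : F.Nonempty :=
  hF.1.1

theorem exists_succ_of_mem_F1 {G : MullerGame V} {F : Set V} (hF : F ∈ G.F1) {x : V}
    (hx : x ∈ F) : ∃ v ∈ F, G.arena.E x v := by
  obtain ⟨v, h, -⟩ := Relation.TransGen.head'_iff.mp (hF.1.2 x hx x hx)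
  exact ⟨v, h.2.1, h.2.2⟩

theorem cls_le_cls {G : MullerGame V} {p q : G.PlaysLE3} :
    G.cls p ≤ G.cls q ↔ Smaller G.F1 p.1 q.1 :=
  Iff.rfl

theorem getLast?_eq_of_cls_eq {G : MullerGame V} {p q : G.PlaysLE3} (h : G.cls p = G.cls q) :
    p.1.getLast? = q.1.getLast? :=
  (cls_le_cls.mp h.le).1

/-- The order is a congruence with respect to appending a letter. -/
theorem cls_append_le {G : MullerGame V} {p p' q q' : G.PlaysLE3} {v : V}
    (h : G.cls p ≤ G.cls p') (hq : q.1 = p.1 ++ [v]) (hq' : q'.1 = p'.1 ++ [v]) :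
    G.cls q ≤ G.cls q' := by
  rw [cls_le_cls, hq, hq']
  exact ⟨by simp, fun F hF =>
    score_acc_append_mono (nonempty_of_mem_F1 hF) ((cls_le_cls.mp h).2 F hF) v⟩

theorem cls_append_eq {G : MullerGame V} {p p' q q' : G.PlaysLE3} {v : V}
    (h : G.cls p = G.cls p') (hq : q.1 = p.1 ++ [v]) (hq' : q'.1 = p'.1 ++ [v]) :
    G.cls q = G.cls q' :=
  le_antisymm (cls_append_le h.le hq hq') (cls_append_le h.ge hq' hq)

theorem isPlayPrefix {G : MullerGame V} (p : G.PlaysLE3) : G.arena.IsPlayPrefix p.1 :=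
  p.2.elim (fun h => h.1) (fun h => h.1)

theorem score_le_two_of_mem_playsLT3 {G : MullerGame V} {w : List V} (hw : w ∈ G.playsLT3)
    {F : Set V} (hF : F ∈ G.F1) : score F w ≤ 2 :=
  (maxScore_le_iff (k := 2)).mp (maxScore_lt_three_iff.mp hw.2) F hF w (List.prefix_refl w)

/-- The score 3 can only occur at the last vertex. -/
theorem mem_playsLT3_of_score_le_two {G : MullerGame V} (p : G.PlaysLE3)
    (h : ∀ F ∈ G.F1, score F p.1 ≤ 2) : p.1 ∈ G.playsLT3 := by
  rcases p.2 with hp | ⟨hp, -, u, v, -, hw, hu⟩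
  · exact hp
  · refine ⟨hp, maxScore_lt_three_iff.mpr ((maxScore_le_iff (k := 2)).mpr fun F hF w hwp => ?_)⟩
    rw [hw] at hwp
    rcases List.prefix_concat_iff.mp hwp with h' | h'
    · rw [h', ← hw]
      exact h F hF
    · exact (maxScore_le_iff (k := 2)).mp hu F hF w h'

theorem mem_playsLT3_of_cls_le {G : MullerGame V} {p : G.PlaysLE3} {a : G.VS} (ha : a ∈ G.safe)
    (h : G.cls p ≤ a) : p.1 ∈ G.playsLT3 := by
  obtain ⟨q, hq, rfl⟩ := ha
  refine mem_playsLT3_of_score_le_two p fun F hF => ?_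
  have h1 := score_le_two_of_mem_playsLT3 hq hF
  rcases (cls_le_cls.mp h).2 F hF with h2 | h2 <;> omega

theorem cls_mem_V0 {G : MullerGame V} {p : G.PlaysLE3} {x : V} (hl : p.1.getLast? = some x) :
    G.cls p ∈ G.arenaS.V0 ↔ x ∈ G.arena.V0 := by
  constructor
  · rintro ⟨q, hq, y, hy, hly⟩
    rw [← getLast?_eq_of_cls_eq hq, hl] at hly
    rwa [Option.some.inj hly]
  · exact fun hx => ⟨p, rfl, x, hx, hl⟩

theorem exists_append {G : MullerGame V} {p : G.PlaysLE3} (hp : p.1 ∈ G.playsLT3) {x v : V}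
    (hl : p.1.getLast? = some x) (hE : G.arena.E x v) : ∃ q : G.PlaysLE3, q.1 = p.1 ++ [v] :=
  ⟨⟨p.1 ++ [v], G.append_mem hp fun y hy => by
    rw [hl, Option.mem_some_iff] at hy
    exact hy ▸ hE⟩, rfl⟩

theorem E_of_append {G : MullerGame V} {p q : G.PlaysLE3} {x v : V}
    (hl : p.1.getLast? = some x) (hq : q.1 = p.1 ++ [v]) : G.arena.E x v := by
  have h := (isPlayPrefix q).2
  rw [hq, List.isChain_append] at h
  exact h.2.2 x hl v (by simp)

/-- The edges of the safety game that leave a safe vertex do not depend on the representative. -/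
theorem exists_append_of_E {G : MullerGame V} {p : G.PlaysLE3} (hp : p.1 ∈ G.playsLT3) {b : G.VS}
    (hE : G.arenaS.E (G.cls p) b) :
    ∃ (q : G.PlaysLE3) (v : V), q.1 = p.1 ++ [v] ∧ b = G.cls q := by
  rcases hE with ⟨p', q', v, hp', hq', hpp', rfl⟩ | ⟨h, -⟩
  · have hl := List.getLast?_eq_some_getLast (isPlayPrefix p).1
    obtain ⟨q, hq⟩ := exists_append hp hl
      (E_of_append ((getLast?_eq_of_cls_eq hpp').symm.trans hl) hq')
    exact ⟨q, v, hq, cls_append_eq hpp'.symm hq' hq⟩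
  · exact absurd ⟨p, hp, rfl⟩ h

theorem gameS_W0_subset_safe (G : MullerGame V) : G.gameS.W0 ⊆ G.safe := by
  rintro a ⟨σ, hσ⟩
  by_contra ha
  have hE : ∀ b, G.arenaS.E a b → b = a := by
    rintro b (⟨p, q, v, hp, -, rfl, -⟩ | ⟨-, h⟩)
    · exact absurd ⟨p, hp, rfl⟩ ha
    · exact h
  exact ha (hσ a rfl (fun _ => a) ⟨fun _ => Or.inr ⟨ha, rfl⟩, rfl,
    fun n hn => (hE _ (Strategy.valid σ _ a hn)).symm⟩ ⟨0, rfl⟩)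

/-- The safety game has a positional strategy that wins from the whole winning region. -/
theorem exists_positional_winsFrom_W0 (G : MullerGame V) :
    ∃ τ : Strategy G.gameS.arena, τ.IsPositional ∧ G.gameS.WinsFrom τ G.gameS.W0 :=
  exists_positional_winsFrom G.gameS_W0_subset_safe
    (fun _ ha => (safetyGame_W0_succ ha).1) (fun _ ha => (safetyGame_W0_succ ha).2)

/-! ### From the Muller game to the safety game -/

/-- If Player 0 wins the Muller game from `v`, then she wins the safety game from the class of
`v`. -/
theorem single_mem_W0 {G : MullerGame V} {v : V} (hv : v ∈ G.toGame.W0) :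
    G.single v ∈ G.gameS.W0 := by
  have := G.arena.finite
  obtain ⟨σ, hσ⟩ := hv
  let A := G.arena
  change Strategy A at σ
  let T := σ.prefixes v
  let X : Set V := {x | ∃ w ∈ T, w.getLast? = some x}
  have htrap : ∀ x ∈ X, x ∉ A.V0 → ∀ y, A.E x y → y ∈ X := fun x ⟨w, hw, hl⟩ hV y hE =>
    ⟨w ++ [y], Strategy.append_mem_prefixes hw hl hE fun h => absurd h hV, by simp⟩
  have hT : WinTree A G.F1 X T := by
    refine ⟨fun w hw => ?_, fun w r hw hr hF1 => ?_⟩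
    · have hne : w ≠ [] := by
        rintro rfl
        exact absurd hw.1 (by simp)
      have hl := List.getLast?_eq_some_getLast hne
      refine ⟨_, ⟨w, hw, hl⟩, hl, fun hV => ?_, fun hV y hy hE =>
        Strategy.append_mem_prefixes hw hl hE fun h => absurd h hV⟩
      have hE := σ.valid w.dropLast _ hV
      have hmem := Strategy.append_mem_prefixes hw hl hE fun _ => rfl
      exact ⟨_, ⟨_, hmem, by simp⟩, hE, hmem⟩
    · obtain ⟨ρ, hρ, hρr⟩ := Strategy.exists_play_of_prefixes hw hr
      have hwin : infi ρ ∈ G.F0 := hσ v rfl ρ hρ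
      exact hF1.2 (hρr ▸ hwin)
  have hvX : v ∈ X := by
    refine ⟨[v], ⟨rfl, by simp, fun u x y h => ?_⟩, rfl⟩
    have := h.length_le
    simp at this
  obtain ⟨S, hS, hvS, hscore⟩ := boundsScores_of_winnable
    (fun F hF x hx => exists_succ_of_mem_F1 hF hx) X (fun x ⟨w, hw, hl⟩ => ⟨T, hT, w, hw, hl⟩)
    [v] v rfl hvX (burden_singleton G.F1 X v)
  let W : Set G.VS := {a | ∃ p : G.PlaysLE3, a = G.cls p ∧ p.1 ∈ S ∧ ∀ x ∈ p.1, x ∈ X}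
  have hLT : ∀ p : G.PlaysLE3, p.1 ∈ S → (∀ x ∈ p.1, x ∈ X) → p.1 ∈ G.playsLT3 := by
    intro p hpS hpX
    refine mem_playsLT3_of_score_le_two p fun F hF => ?_
    by_cases hFX : F ⊆ X
    · exact hscore _ hpS F hF hFX
    · rw [score_eq_zero_of_not_subset fun h => hFX fun x hx => hpX x (h hx)]
      omega
  have hmemX : ∀ (p q : G.PlaysLE3) (y : V), (∀ x ∈ p.1, x ∈ X) → y ∈ X → q.1 = p.1 ++ [y] →
      ∀ x ∈ q.1, x ∈ X := by
    intro p q y hp hy hq x hx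
    rw [hq, List.mem_append, List.mem_singleton] at hx
    rcases hx with hx | rfl
    · exact hp x hx
    · exact hy
  obtain ⟨τ, -, hτ⟩ := exists_positional_winsFrom (A := G.arenaS) (F := G.safe) (W := W)
    (fun a ⟨p, hp, hpS, hpX⟩ => ⟨p, hLT p hpS hpX, hp⟩)
    (by
      rintro a ⟨p, rfl, hpS, hpX⟩ hV
      obtain ⟨x, hx, hl, h0, -⟩ := hS p.1 hpS
      obtain ⟨y, hy, hE, hyS⟩ := h0 ((cls_mem_V0 hl).mp hV)
      obtain ⟨q, hq⟩ := exists_append (hLT p hpS hpX) hl hE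
      exact ⟨G.cls q, ⟨q, rfl, hq ▸ hyS, hmemX p q y hpX hy hq⟩,
        Or.inl ⟨p, q, y, hLT p hpS hpX, hq, rfl, rfl⟩⟩)
    (by
      rintro a ⟨p, rfl, hpS, hpX⟩ hV b hab
      obtain ⟨x, hx, hl, -, h1⟩ := hS p.1 hpS
      obtain ⟨q, y, hq, rfl⟩ := exists_append_of_E (hLT p hpS hpX) hab
      have hxV : x ∉ A.V0 := fun h => hV ((cls_mem_V0 hl).mpr h)
      have hE := E_of_append hl hq
      have hy := htrap x hx hxV y hE
      exact ⟨q, rfl, hq ▸ h1 hxV y hy hE, hmemX p q y hpX hy hq⟩)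
  refine ⟨τ, ?_⟩
  rintro _ rfl
  refine hτ _ ⟨_, rfl, hvS, fun x hx => ?_⟩
  rw [List.mem_singleton.mp hx]
  exact hvX

/-! ### The reachable vertices -/

section Reach

variable {G : MullerGame V} {τ : Strategy G.gameS.arena}

theorem single_mem_reach (hτ : τ.IsPositional) {v : V} (hv : G.single v ∈ G.gameS.W0) :
    G.single v ∈ G.reach τ := by
  obtain ⟨ρ, hρ⟩ := hτ.Beh_nonempty (G.single v)
  exact ⟨v, hv, ρ, hρ, 0, hρ.2.1⟩

theorem reach_succ (hτ : τ.IsPositional) {a b : G.VS} (ha : a ∈ G.reach τ)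
    (hE : G.arenaS.E a b) (hb : a ∈ G.arenaS.V0 → b = τ.move [] a) : b ∈ G.reach τ := by
  obtain ⟨v, hv, ρ, hρ, n, rfl⟩ := ha
  obtain ⟨ρ', hρ'⟩ := hτ.Beh_nonempty b
  have h1 := Strategy.cons_mem_Beh (σ := τ) hE hb (by rwa [hτ.shift_Beh])
  refine ⟨v, hv, _, hτ.splice hρ n h1, n + 1, ?_⟩
  simp [hρ'.2.1]

theorem reach_subset_W0 (hτ : τ.IsPositional) (hwin : G.gameS.WinsFrom τ G.gameS.W0) :
    G.reach τ ⊆ G.gameS.W0 := by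
  rintro a ⟨v, hv, ρ, hρ, n, rfl⟩
  refine ⟨τ, ?_⟩
  rintro _ rfl ρ' hρ' _ ⟨k, rfl⟩
  refine hwin _ hv _ (hτ.splice hρ n hρ') ⟨n + k, ?_⟩
  simp

theorem exists_le_reachMax {a : G.VS} (ha : a ∈ G.reach τ) :
    ∃ m : G.reachMax τ, a ≤ m.1 := by
  have := G.finite_VS
  obtain ⟨m, ham, hm⟩ := (Set.toFinite (G.reach τ)).exists_le_maximal ha
  exact ⟨⟨m, hm⟩, ham⟩

end Reach

end MullerGame

/-! ### Maximal reachable classes as memory -/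

theorem MemoryStructure.updateStar_append {M : Type*} (𝔐 : MemoryStructure V M) {w : List V}
    (hw : w ≠ []) (v : V) :
    𝔐.updateStar (w ++ [v]) (by simp) = 𝔐.update (𝔐.updateStar w hw) v := by
  cases w with
  | nil => exact absurd rfl hw
  | cons x w => simp [MemoryStructure.updateStar]

namespace MullerGame

/-- A play all of whose prefixes keep the scores of Player 1 at most 2 is won by Player 0. -/
theorem infi_mem_F0 {G : MullerGame V} {ρ : ℕ → V} (hρ : G.arena.IsPlay ρ)
    (h : ∀ n, before ρ n ++ [ρ n] ∈ G.playsLT3) : infi ρ ∈ G.F0 := by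
  have := G.arena.finite
  by_contra hF
  obtain ⟨n, hn⟩ := exists_score_infi_ge ρ 3
  rcases n with _ | n
  · exact absurd hn (by simp [before, score, scoreAcc])
  · rw [before_succ] at hn
    have := score_le_two_of_mem_playsLT3 (h n) ⟨isLoop_infi hρ, hF⟩
    omega

/-- The memory keeps a maximal reachable class above the class of the play prefix seen so far, and
the next move is the one that `τ` makes at this class. Appending a vertex is monotone, so the
comparison is preserved, and classes below a safe class are safe. -/
theorem exists_memoryStructure (G : MullerGame V) (hne : G.toGame.W0.Nonempty)
    {τ : Strategy G.gameS.arena} (hτ : τ.IsPositional)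
    (hwin : G.gameS.WinsFrom τ G.gameS.W0) :
    ∃ (𝔐 : MemoryStructure V (G.reachMax τ)) (next : NextMove G.toGame.arena (G.reachMax τ)),
      ∀ v ∈ G.toGame.W0, ∀ ρ ∈ (𝔐.strategy next).Beh v, ∀ n,
        ∃ p : G.PlaysLE3, p.1 = before ρ n ++ [ρ n] ∧ p.1 ∈ G.playsLT3 ∧
          G.cls p ≤ (𝔐.updateStar (before ρ n ++ [ρ n]) (by simp)).1 := by
  have hfin := G.finite_VS
  obtain ⟨m₀, -⟩ : ∃ m : G.reachMax τ, G.single hne.some ≤ m.1 :=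
    exists_le_reachMax (single_mem_reach hτ (single_mem_W0 hne.some_mem))
  have hsafe : ∀ m : G.reachMax τ, m.1 ∈ G.safe := fun m =>
    G.gameS_W0_subset_safe (reach_subset_W0 hτ hwin m.2.1)
  have hinit : ∀ v, ∃ m : G.reachMax τ, G.single v ∈ G.reach τ → G.single v ≤ m.1 := by
    intro v
    by_cases h : G.single v ∈ G.reach τ
    · exact (exists_le_reachMax h).imp fun m hm _ => hm
    · exact ⟨m₀, fun h' => absurd h' h⟩
  have hupd : ∀ (m : G.reachMax τ) (v : V), ∃ m' : G.reachMax τ, ∀ p q : G.PlaysLE3,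
      G.cls p = m.1 → q.1 = p.1 ++ [v] → G.cls q ∈ G.reach τ → G.cls q ≤ m'.1 := by
    intro m v
    by_cases h : ∃ p q : G.PlaysLE3, G.cls p = m.1 ∧ q.1 = p.1 ++ [v] ∧ G.cls q ∈ G.reach τ
    · obtain ⟨p, q, hp, hq, hqR⟩ := h
      obtain ⟨m', hm'⟩ := exists_le_reachMax hqR
      exact ⟨m', fun p' q' hp' hq' _ => (cls_append_eq (hp'.trans hp.symm) hq' hq).le.trans hm'⟩
    · exact ⟨m₀, fun p q h1 h2 h3 => absurd ⟨p, q, h1, h2, h3⟩ h⟩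
  have hnxt : ∀ (v : V) (m : G.reachMax τ), ∃ v', (v ∈ G.arena.V0 → G.arena.E v v') ∧
      ∀ p q : G.PlaysLE3, G.cls p = m.1 → p.1.getLast? = some v → v ∈ G.arena.V0 →
        q.1 = p.1 ++ [v'] → G.cls q = τ.move [] m.1 := by
    intro v m
    by_cases h : v ∈ G.arena.V0 ∧ ∃ p : G.PlaysLE3, G.cls p = m.1 ∧ p.1.getLast? = some v
    · obtain ⟨hV, p, hp, hl⟩ := h
      have hpLT := mem_playsLT3_of_cls_le (hsafe m) hp.le
      have hE : G.arenaS.E (G.cls p) (τ.move [] (G.cls p)) :=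
        τ.valid [] (G.cls p) ((cls_mem_V0 hl).mpr hV)
      obtain ⟨q, v', hq, hqτ⟩ := exists_append_of_E hpLT hE
      refine ⟨v', fun _ => E_of_append hl hq, fun p' q' hp' _ _ hq' => ?_⟩
      rw [cls_append_eq (hp'.trans hp.symm) hq' hq, ← hqτ, hp]
    · obtain ⟨v', hv'⟩ := G.arena.total v
      exact ⟨v', fun _ => hv', fun p q h1 h2 h3 _ => absurd ⟨h3, p, h1, h2⟩ h⟩
  -- `hupd` and `hnxt` hold for all representatives of a class, so they apply to any of them below
  choose init hinit using hinit
  choose upd hupd using hupd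
  choose nxt hnxtE hnxt using hnxt
  let 𝔐 : MemoryStructure V (G.reachMax τ) := ⟨inferInstance, init, upd⟩
  let next : NextMove G.toGame.arena (G.reachMax τ) := ⟨nxt, fun v hv m => hnxtE v m hv⟩
  refine ⟨𝔐, next, ?_⟩
  rintro v hv ρ ⟨hplay, rfl, hcons⟩ n
  induction n with
  | zero =>
    exact ⟨⟨[ρ 0], Or.inl (G.singleton_mem (ρ 0))⟩, rfl, G.singleton_mem (ρ 0),
      hinit (ρ 0) (single_mem_reach hτ (single_mem_W0 hv))⟩
  | succ n ih =>
    obtain ⟨p, hp, hpLT, hpm⟩ := ih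
    have hstar : 𝔐.updateStar (before ρ (n + 1) ++ [ρ (n + 1)]) (by simp) =
        upd (𝔐.updateStar (before ρ n ++ [ρ n]) (by simp)) (ρ (n + 1)) := by
      simp only [before_succ]
      exact 𝔐.updateStar_append (by simp) _
    rw [hstar]
    have hmove : ρ n ∈ G.arena.V0 →
        ρ (n + 1) = nxt (ρ n) (𝔐.updateStar (before ρ n ++ [ρ n]) (by simp)) := hcons n
    generalize 𝔐.updateStar (before ρ n ++ [ρ n]) (by simp) = m at hpm hmove
    have hl : p.1.getLast? = some (ρ n) := by rw [hp]; simp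
    have hE : G.arena.E (ρ n) (ρ (n + 1)) := hplay n
    obtain ⟨p', hp'LT, hp'⟩ := hsafe m
    rw [hp'] at hpm
    have hl' : p'.1.getLast? = some (ρ n) := (cls_le_cls.mp hpm).1.symm.trans hl
    obtain ⟨q, hq⟩ := exists_append hpLT hl hE
    obtain ⟨q', hq'⟩ := exists_append hp'LT hl' hE
    have hq'R : G.cls q' ∈ G.reach τ := by
      refine reach_succ hτ m.2.1 (Or.inl ⟨p', q', _, hp'LT, hq', hp', rfl⟩) fun hV => ?_
      rw [hp', cls_mem_V0 hl'] at hV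
      have := hmove hV
      rw [this] at hq'
      exact hnxt _ m p' q' hp'.symm hl' hV hq'
    have hle : G.cls q ≤ (upd m (ρ (n + 1))).1 :=
      (cls_append_le hpm hq hq').trans (hupd m _ p' q' hp'.symm hq' hq'R)
    exact ⟨q, by rw [hq, hp, before_succ], mem_playsLT3_of_cls_le (hsafe _) hle, hle⟩

end MullerGame

end MullerSafety

theorem mainTheorem2 {V : Type*} (G : MullerGame V) (hne : G.toGame.W0.Nonempty) :
    (∃ τ : Strategy G.gameS.arena, τ.IsPositional ∧ G.gameS.WinsFrom τ G.gameS.W0) ∧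
    ∀ τ : Strategy G.gameS.arena, τ.IsPositional → G.gameS.WinsFrom τ G.gameS.W0 →
      G.reachMax τ ⊆ G.gameS.W0 ∧
      IsAntichain (· ≤ ·) (G.reachMax τ) ∧
      ∃ (𝔐 : MemoryStructure V (G.reachMax τ))
        (next : NextMove G.toGame.arena (G.reachMax τ)),
        G.toGame.WinsFrom (𝔐.strategy next) G.toGame.W0 ∧
        ∀ v ∈ G.toGame.W0, ∀ ρ ∈ (𝔐.strategy next).Beh v, ∀ n,
          ∃ p : G.PlaysLE3, p.1 = before ρ n ++ [ρ n] ∧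
            G.cls p ≤ (𝔐.updateStar (before ρ n ++ [ρ n]) (by simp)).1 := by
  refine ⟨G.exists_positional_winsFrom_W0, fun τ hτ hwin => ⟨fun a ha =>
    MullerGame.reach_subset_W0 hτ hwin ha.1, fun a ha b hb hne hab =>
      hne (hab.antisymm (ha.2 hb.1 hab)), ?_⟩⟩
  obtain ⟨𝔐, next, h⟩ := G.exists_memoryStructure hne hτ hwin
  refine ⟨𝔐, next, fun v hv ρ hρ => ?_, fun v hv ρ hρ n => ?_⟩
  · refine MullerGame.infi_mem_F0 hρ.1 fun n => ?_
    obtain ⟨p, hp, hpLT, -⟩ := h v hv ρ hρ n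
    exact hp ▸ hpLT
  · obtain ⟨p, hp, -, hle⟩ := h v hv ρ hρ n
    exact ⟨p, hp, hle⟩
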